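/- **Proposition 2.8 (bijective correspondence).** *LVMB data.* Let $m,n$ be positive integers with $2m\le n$. An LVMB datum is a pair $(\mathcal L,\mathcal E_{m,n})$ where $\mathcal L=(\ell_0,\dots,\ell_n)$ is a family of $n+1$ linear forms on $\mathbb C^m$ and $\mathcal E_{m,n}$ is a non-empty family of subsets of $\{0,\dots,n\}$, each with $2m+1$ elements, such that, writing $\mathcal L_P=(\ell_i)_{i\in P}$: - for every $P\in\mathcal E_{m,n}$, $\mathcal L_P$ is a real affine basis of $(\mathbb C^m)^*$; - (SEP) for all $P\in\mathcal E_{m,n}$ and $i\in\{0,\dots,n\}$ there is $j\in P$ with $(P\setminus\{j\})\cup\{i\}\in\mathcal E_{m,n}$; - (imbrication) for all $P,Q\in\mathcal E_{m,n}$, the interiors of the convex hulls of $\mathcal L_P$ and $\mathcal L_Q$ have a common point. Write $(\mathcal L,\mathcal E_{m,n})\approx(\mathcal L',\mathcal E'_{m',n'})$ if $m=m'$, $n=n'$, $\mathcal E_{m,n}=\mathcal E'_{m',n'}$, and there is a real affine automorphism $\varphi$ of $(\mathbb C^m)^*$ carrying the family $\mathcal L$ onto the family $\mathcal L'$, i.e.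 $\varphi(\ell_i)=\ell'_i$ for all $i$. This is an equivalence relation. *Toric data.* Let $(e_1,\dots,e_n)$ be the canonical basis of $\mathbb R^n$ and $e_0=-(e_1+\dots+e_n)$. Cones are finitely generated convex cones containing no line, a face of a cone is its zero locus under a linear form that is non-negative on it, and a fan is a set of cones closed under taking faces in which any two cones intersect in a common face. Let $\Delta_{\mathbb P^n(\mathbb C)}$ be the fan in $\mathbb R^n$ consisting of the $n+1$ cones generated by $n$ of the vectors $e_0,\dots,e_n$, and their faces. Let $\mathcal P$ be the set of all pairs $(E,\Delta)$ (with varying $n$ and $m\ge1$) where $E$ is a $2m$-dimensional linear subspace of $\mathbb R^n$ and $\Delta$ is a fan all of whose cones belong to $\Delta_{\mathbb P^n(\mathbb C)}$, such that a) the projection $\pi:\mathbb R^n\to\mathbb R^n/E$ is injective on the support $|\Delta|=\bigcup_{\sigma\in\Delta}\sigma$; b) $\pi(\Delta)=\{\pi(\sigma):\sigma\in\Delta\}$ is complete, i.e. $|\pi(\Delta)|=\mathbb R^n/E$. *The pair of a datum.* To an LVMB datum $(\mathcal L,\mathcal E_{m,n})$ associate the pair $(E,\Delta)$, where $$E=\{(-\log|e^{\ell_1(Z)-\ell_0(Z)}|,\dots,-\log|e^{\ell_n(Z)-\ell_0(Z)}|):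 Z\in\mathbb C^m\}\subset\mathbb R^n$$ and $\Delta$ consists of the cones generated by $\{e_i : i\notin P\}$, $P\in\mathcal E_{m,n}$, and their faces. **Statement.** The assignment $(\mathcal L,\mathcal E_{m,n})\mapsto(E,\Delta)$ induces a bijection $$\{\text{LVMB data}\}/\approx\ \longrightarrow\ \mathcal P .$$ In particular the pair of every LVMB datum lies in $\mathcal P$, two LVMB data have the same pair if and only if they are equivalent under $\approx$, and every element of $\mathcal P$ is the pair of some LVMB datum. -/

import Mathlib

namespace LVMB

section Fans

variable {V : Type*} [AddCommGroup V] [Module ℝ V]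

/-- The set `∑_{i ∈ S} ℝ≥0 v_i` of nonnegative combinations of the vectors `v i`, `i ∈ S`. -/
def coneSpan {ι : Type*} (v : ι → V) (S : Finset ι) : Set V :=
  {x | ∃ c : ι → ℝ, (∀ i, 0 ≤ c i) ∧ x = ∑ i ∈ S, c i • v i}

/-- Convex polyhedral cones with apex at the origin: finitely generated and containing no line. -/
def IsPolyhedralCone (σ : Set V) : Prop :=
  (∃ (k : ℕ) (v : Fin k → V), σ = coneSpan v Finset.univ) ∧ {x | x ∈ σ ∧ -x ∈ σ} = {0}

/-- `τ` is a face of `σ`: it is the zero locus in `σ` of a linear form that is nonnegative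
on `σ`. -/
def IsFace (τ σ : Set V) : Prop :=
  ∃ φ : Module.Dual ℝ V, (∀ x ∈ σ, 0 ≤ φ x) ∧ τ = {x | x ∈ σ ∧ φ x = 0}

/-- Fans of (not necessarily rational) cones. -/
structure IsFan (Δ : Set (Set V)) : Prop where
  cone : ∀ σ ∈ Δ, IsPolyhedralCone σ
  face_mem : ∀ σ ∈ Δ, ∀ τ, IsFace τ σ → τ ∈ Δ
  inter_face : ∀ σ ∈ Δ, ∀ τ ∈ Δ, IsFace (σ ∩ τ) σ ∧ IsFace (σ ∩ τ) τ

/-- The support `|Δ|`. -/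
def fanSupport (Δ : Set (Set V)) : Set V := ⋃₀ Δ

/-- The collection `π(Δ)` of the images of the cones of `Δ` under the projection `π : V → V / E`. -/
def projectFan (E : Submodule ℝ V) (Δ : Set (Set V)) : Set (Set (V ⧸ E)) :=
  (fun σ => E.mkQ '' σ) '' Δ

end Fans

/-- The vectors `e_0 = -(e_1 + ... + e_n), e_1, ..., e_n` of `ℝⁿ`. The canonical basis vector
`e_k` is `Pi.single i 1` with `i : Fin n` and `k = i.succ`. -/
def ray (n : ℕ) : Fin (n + 1) → (Fin n → ℝ) :=
  Fin.cons (-∑ i : Fin n, Pi.single i (1 : ℝ)) (fun i : Fin n => Pi.single i (1 : ℝ))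

/-- The fan of `ℙⁿ(ℂ)`: the `n + 1` cones generated by `n` of the `n + 1` vectors
`e_0, ..., e_n`, and their faces. -/
def projectiveFan (n : ℕ) : Set (Set (Fin n → ℝ)) :=
  {τ | ∃ i : Fin (n + 1), IsFace τ (coneSpan (ray n) (Finset.univ.erase i))}

/-- The type of all pairs `(E, Δ)`, for a varying `n`, where `E` is a linear subspace of `ℝⁿ` and
`Δ` is a collection of subsets of `ℝⁿ`. -/
abbrev PrePair : Type :=
  Σ n : ℕ, Submodule ℝ (Fin n → ℝ) × Set (Set (Fin n → ℝ))

/-- The set `𝒫` of the pairs `(E, Δ)`, where `E` is a linear subspace of `ℝⁿ` of dimension `2m`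
for some `m ≥ 1` and `Δ` is a subfan of the fan of `ℙⁿ(ℂ)`, such that
a) the projection `π : ℝⁿ → ℝⁿ / E` is injective on `|Δ|`,
b) `π(Δ)` is complete, that is, `|π(Δ)| = ℝⁿ / E`. -/
def toricPairs : Set PrePair :=
  {p | (∃ m : ℕ, 0 < m ∧ Module.finrank ℝ p.2.1 = 2 * m) ∧
    IsFan p.2.2 ∧ p.2.2 ⊆ projectiveFan p.1 ∧
    Set.InjOn p.2.1.mkQ (fanSupport p.2.2) ∧
    fanSupport (projectFan p.2.1 p.2.2) = Set.univ}

/-- LVMB data: positive integers `m, n` with `2m ≤ n`, linear forms `ℓ_0, ..., ℓ_n` on `ℂᵐ` and a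
non-empty family `𝓔` of subsets of `{0, ..., n}` with `2m + 1` elements, such that each `L_P`,
`P ∈ 𝓔`, is a real affine basis of `(ℂᵐ)*` and such that the substitute existence principle and
the imbrication condition hold. -/
structure Datum where
  m : ℕ
  n : ℕ
  m_pos : 0 < m
  two_mul_m_le : 2 * m ≤ n
  ℓ : Fin (n + 1) → StrongDual ℂ (Fin m → ℂ)
  𝓔 : Set (Finset (Fin (n + 1)))
  nonempty : 𝓔.Nonempty
  card_eq : ∀ P ∈ 𝓔, P.card = 2 * m + 1
  affine_basis : ∀ P ∈ 𝓔, AffineIndependent ℝ (fun i : P => ℓ i) ∧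
    affineSpan ℝ (ℓ '' (P : Set (Fin (n + 1)))) = ⊤
  sep : ∀ P ∈ 𝓔, ∀ i, ∃ j ∈ P, insert i (P.erase j) ∈ 𝓔
  imbrication : ∀ P ∈ 𝓔, ∀ Q ∈ 𝓔,
    (interior (convexHull ℝ (ℓ '' (P : Set (Fin (n + 1))))) ∩
      interior (convexHull ℝ (ℓ '' (Q : Set (Fin (n + 1)))))).Nonempty

namespace Datum

/-- The relation `≈`: the integers `m`, `n` and the index families agree, and a real affine
automorphism of `(ℂᵐ)*` carries the family `(ℓ_0, ..., ℓ_n)` onto `(ℓ'_0, ..., ℓ'_n)`. -/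
def Rel (d d' : Datum) : Prop :=
  d.m = d'.m ∧ ∃ hn : d.n + 1 = d'.n + 1,
    (∀ P, P ∈ d.𝓔 ↔ P.map (finCongr hn).toEmbedding ∈ d'.𝓔) ∧
    ∃ φ : StrongDual ℂ (Fin d.m → ℂ) ≃ᵃ[ℝ] StrongDual ℂ (Fin d'.m → ℂ),
      ∀ i, φ (d.ℓ i) = d'.ℓ (Fin.cast hn i)

theorem map_finCongr_self {k : ℕ} (h : k = k) (P : Finset (Fin k)) :
    P.map (finCongr h).toEmbedding = P := by
  ext x
  simp

theorem rel_equivalence : Equivalence Rel := by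
  refine ⟨fun d => ⟨rfl, rfl, fun P => by rw [map_finCongr_self], AffineEquiv.refl ℝ _,
    fun i => rfl⟩, ?_, ?_⟩
  · rintro ⟨m, n, _, _, ℓ, 𝓔, _, _, _, _, _⟩ ⟨m', n', _, _, ℓ', 𝓔', _, _, _, _, _⟩
      ⟨hm, hn, h𝓔, φ, hφ⟩
    dsimp only at hm hn h𝓔 φ hφ
    obtain rfl : n = n' := Nat.succ_injective hn
    subst hm
    refine ⟨rfl, rfl, fun P => ?_, φ.symm, fun i => ?_⟩
    · have := h𝓔 P
      rw [map_finCongr_self] at this ⊢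
      exact this.symm
    · exact (AffineEquiv.symm_apply_eq φ).2 (hφ i).symm
  · rintro ⟨m, n, _, _, ℓ, 𝓔, _, _, _, _, _⟩ ⟨m', n', _, _, ℓ', 𝓔', _, _, _, _, _⟩
      ⟨m'', n'', _, _, ℓ'', 𝓔'', _, _, _, _, _⟩ ⟨hm, hn, h𝓔, φ, hφ⟩ ⟨hm', hn', h𝓔', ψ, hψ⟩
    dsimp only at hm hn h𝓔 φ hφ hm' hn' h𝓔' ψ hψ
    obtain rfl : n = n' := Nat.succ_injective hn
    obtain rfl : n = n'' := Nat.succ_injective hn'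
    subst hm hm'
    refine ⟨rfl, rfl, fun P => ?_, φ.trans ψ, fun i => ?_⟩
    · have h1 := h𝓔 P
      have h2 := h𝓔' P
      rw [map_finCongr_self] at h1 h2 ⊢
      exact h1.trans h2
    · change ψ (φ (ℓ i)) = _
      rw [hφ i]
      exact hψ i

/-- `≈` as a setoid. -/
def setoid : Setoid Datum := ⟨Rel, rel_equivalence⟩

/-- The real-linear map `ℂᵐ → ℝⁿ` with coordinates `Z ↦ -Re (ℓ_i(Z) - ℓ_0(Z))`, `1 ≤ i ≤ n`. -/
noncomputable def ordMap (d : Datum) : (Fin d.m → ℂ) →ₗ[ℝ] (Fin d.n → ℝ) where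
  toFun Z := fun i => -(d.ℓ i.succ Z - d.ℓ 0 Z).re
  map_add' Z W := by
    ext i
    simp only [map_add, Complex.sub_re, Complex.add_re, Pi.add_apply]
    ring
  map_smul' c Z := by
    ext i
    have h : ∀ f : StrongDual ℂ (Fin d.m → ℂ), f (c • Z) = (c : ℂ) * f Z := fun f => by
      rw [← Complex.coe_smul, map_smul, smul_eq_mul]
    simp only [h, Complex.sub_re, Complex.re_ofReal_mul, Pi.smul_apply, smul_eq_mul,
      RingHom.id_apply]
    ring

/-- The subspace `E` of `ℝⁿ` of a datum: the image of `ℂᵐ` (see `mem_subspace_iff`). -/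
noncomputable def subspace (d : Datum) : Submodule ℝ (Fin d.n → ℝ) := LinearMap.range d.ordMap

/-- `E` is the image under `ord (z_1, ..., z_n) = (-log |z_1|, ..., -log |z_n|)` of the
subgroup `{(exp (ℓ_1(Z) - ℓ_0(Z)), ..., exp (ℓ_n(Z) - ℓ_0(Z))) : Z ∈ ℂᵐ}` of `(ℂ*)ⁿ`. -/
theorem mem_subspace_iff (d : Datum) (x : Fin d.n → ℝ) :
    x ∈ d.subspace ↔ ∃ Z : Fin d.m → ℂ,
      x = fun i => -Real.log ‖Complex.exp (d.ℓ i.succ Z - d.ℓ 0 Z)‖ := by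
  simp only [subspace, LinearMap.mem_range, Complex.norm_exp, Real.log_exp]
  exact ⟨fun ⟨Z, h⟩ => ⟨Z, h.symm⟩, fun ⟨Z, h⟩ => ⟨Z, h.symm⟩⟩

/-- The fan `Δ` of a datum: the cones `σ_P`, `P ∈ 𝓔`, generated by the `e_i` with `i ∉ P`, and
their faces. -/
def fan (d : Datum) : Set (Set (Fin d.n → ℝ)) :=
  {τ | ∃ P ∈ d.𝓔, IsFace τ (coneSpan (ray d.n) Pᶜ)}

/-- The pair `(E, Δ)` of a datum. -/
noncomputable def toricPair (d : Datum) : PrePair := ⟨d.n, d.subspace, d.fan⟩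

end Datum

end LVMB

namespace LVMB

/-! ### Covering a finite-dimensional space by simplicial cones. -/

section ConeGeometry

open Filter Topology Module

/-! The only linear relations among the rays come from `e_0 + ... + e_n = 0`, so a point of `ℝⁿ` is
a coefficient vector `u` on `{0, ..., n}` up to a constant. The bridge is
`sum_smul_ray_mem_subspace_iff`: the point `∑ u_i e_i` lies in `E` iff `u_i = f (ℓ_i)` for a real
affine function `f` on `(ℂᵐ)*`.

Imbrication corresponds to injectivity of `π`. If two points of the cones `σ_P`, `σ_Q` have the same
image, the difference of their coefficients is some `f (ℓ_i)` with `f ≤ 0` on `L_P` and `f ≥ 0` on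
`L_Q`; a common interior point of the hulls forces `f = 0`. Conversely, hulls with disjoint
interiors are separated by a nonzero such `f`, whose positive and negative parts would give distinct
points with the same image.

SEP corresponds to completeness. On complements it says that each facet of a maximal cone is shared
with another maximal cone. Following a generic segment across facets then reaches every point
(`exists_mem_coneSpan_of_exchange`); conversely, a path leaving a cone of a complete fan through a
facet enters a neighbour (`exists_exchange_of_forall_mem_coneSpan`).

Finally, `E` determines the forms up to a real affine automorphism, and `Δ` determines the index
family through its maximal cones. -/

theorem mem_coneSpan_of_nonneg {V ι : Type*} [AddCommGroup V] [Module ℝ V] {v : ι → V}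
    {S : Finset ι} {c : ι → ℝ} (hc : ∀ i ∈ S, 0 ≤ c i) : ∑ i ∈ S, c i • v i ∈ coneSpan v S := by
  classical
  refine ⟨fun i => if i ∈ S then c i else 0, fun i => ?_, Finset.sum_congr rfl fun i hi => ?_⟩
  · dsimp only
    split_ifs with h
    exacts [hc i h, le_rfl]
  · simp [hi]

theorem coneSpan_mono {V ι : Type*} [AddCommGroup V] [Module ℝ V] {v : ι → V}
    {S T : Finset ι} (h : S ⊆ T) : coneSpan v S ⊆ coneSpan v T := by
  classical
  rintro x ⟨c, hc, rfl⟩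
  have : ∑ i ∈ S, c i • v i = ∑ i ∈ T, (if i ∈ S then c i else 0) • v i := by
    rw [← Finset.sum_subset h (fun i _ hi => by simp [hi])]
    exact Finset.sum_congr rfl fun i hi => by simp [hi]
  rw [this]
  refine mem_coneSpan_of_nonneg fun i _ => ?_
  split_ifs
  exacts [hc i, le_rfl]

theorem image_coneSpan {V W ι : Type*} [AddCommGroup V] [Module ℝ V] [AddCommGroup W] [Module ℝ W]
    (f : V →ₗ[ℝ] W) (v : ι → V) (S : Finset ι) :
    f '' coneSpan v S = coneSpan (fun i => f (v i)) S := by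
  ext x
  constructor
  · rintro ⟨_, ⟨c, hc, rfl⟩, rfl⟩
    exact ⟨c, hc, by simp⟩
  · rintro ⟨c, hc, rfl⟩
    exact ⟨_, ⟨c, hc, rfl⟩, by simp⟩

theorem mem_coneSpan_iff_coord {V ι : Type*} [AddCommGroup V] [Module ℝ V] {v : ι → V} {I : Finset ι} {c : ι → V →ₗ[ℝ] ℝ}
    (hc : ∀ x, ∑ i ∈ I, c i x • v i = x)
    (hc' : ∀ u : ι → ℝ, ∀ i ∈ I, c i (∑ k ∈ I, u k • v k) = u i) (x : V) :
    x ∈ coneSpan v I ↔ ∀ i ∈ I, 0 ≤ c i x := by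
  constructor
  · rintro ⟨u, hu, rfl⟩ i hi
    rw [hc' u i hi]
    exact hu i
  · intro h
    rw [← hc x]
    exact mem_coneSpan_of_nonneg h

theorem coord_eq_zero_of_mem_span_erase {V ι : Type*} [AddCommGroup V] [Module ℝ V] [DecidableEq ι]
    {v : ι → V} {I : Finset ι}
    {c : ι → V →ₗ[ℝ] ℝ} (hc' : ∀ u : ι → ℝ, ∀ i ∈ I, c i (∑ k ∈ I, u k • v k) = u i)
    {i : ι} (hi : i ∈ I) {J : Finset ι} (hJ : J ⊆ I.erase i) {u : ι → ℝ} :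
    c i (∑ k ∈ J, u k • v k) = 0 := by
  have h1 : ∑ k ∈ J, u k • v k = ∑ k ∈ I, (if k ∈ J then u k else 0) • v k := by
    rw [← Finset.sum_subset (hJ.trans (Finset.erase_subset _ _)) (fun k _ hk => by simp [hk])]
    exact Finset.sum_congr rfl fun k hk => by simp [hk]
  have h2 : i ∉ J := fun h => by simpa using hJ h
  rw [h1, hc' _ i hi, if_neg h2]

/-- Two full-dimensional cones which share the facet opposite to `i` and have no common interior
point lie on different sides of this facet. -/
theorem coord_neg_of_inter_facet {V ι : Type*} [AddCommGroup V] [Module ℝ V] [DecidableEq ι]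
    {v : ι → V} {I : Finset ι}
    {c : ι → V →ₗ[ℝ] ℝ} (hc : ∀ x, ∑ i ∈ I, c i x • v i = x)
    (hc' : ∀ u : ι → ℝ, ∀ i ∈ I, c i (∑ k ∈ I, u k • v k) = u i)
    {i j : ι} (hi : i ∈ I) (hj : j ∉ I)
    (hli : LinearIndependent ℝ (fun k : (insert j (I.erase i) : Finset ι) => v k))
    (meet : ∀ x ∈ coneSpan v I, x ∈ coneSpan v (insert j (I.erase i)) →
      x ∈ coneSpan v (I ∩ insert j (I.erase i))) : c i (v j) < 0 := by
  have hj' : j ∉ I.erase i := fun h => hj (Finset.mem_of_mem_erase h)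
  -- If `c i (v j) ≥ 0`, adding a large multiple of the facet generators to `v j` gives a point of
  -- both cones. It must lie in the common facet, so `c i (v j) = 0`, which makes the generators of
  -- the second cone dependent.
  by_contra! hneg
  obtain ⟨N, hN⟩ : ∃ N : ℝ, ∀ k ∈ I, -c k (v j) ≤ N := by
    obtain ⟨N, hN⟩ := (I.image fun k => -c k (v j)).exists_le
    exact ⟨N, fun k hk => hN _ (Finset.mem_image_of_mem _ hk)⟩
  set N' := max N 0
  have h1 : v j + ∑ k ∈ I.erase i, N' • v k ∈ coneSpan v (insert j (I.erase i)) := by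
    have : v j + ∑ k ∈ I.erase i, N' • v k
        = ∑ k ∈ insert j (I.erase i), (if k = j then 1 else N') • v k := by
      rw [Finset.sum_insert hj']
      simp only [if_true, one_smul]
      congr 1
      exact Finset.sum_congr rfl fun k hk => by rw [if_neg (show k ≠ j from fun h => hj' (h ▸ hk))]
    rw [this]
    refine mem_coneSpan_of_nonneg fun k _ => ?_
    split_ifs
    exacts [zero_le_one, le_max_right _ _]
  have hsum : ∀ k ∈ I, c k (∑ l ∈ I.erase i, N' • v l) = if k = i then 0 else N' := by
    intro k hk
    have : ∑ l ∈ I.erase i, N' • v l = ∑ l ∈ I, (if l = i then 0 else N') • v l := by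
      rw [← Finset.add_sum_erase I _ hi]
      simp only [if_true, zero_smul, zero_add]
      exact Finset.sum_congr rfl fun l hl => by rw [if_neg (Finset.ne_of_mem_erase hl)]
    rw [this, hc' _ k hk]
  have h2 : v j + ∑ k ∈ I.erase i, N' • v k ∈ coneSpan v I := by
    rw [mem_coneSpan_iff_coord hc hc']
    intro k hk
    rw [map_add, hsum k hk]
    split_ifs with h
    · rw [h, add_zero]; exact hneg
    · have := hN k hk
      have := le_max_left N 0
      linarith
  have h3 := meet _ h2 h1
  have hsub : I ∩ insert j (I.erase i) ⊆ I.erase i := by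
    intro k hk
    rw [Finset.mem_inter, Finset.mem_insert] at hk
    rcases hk with ⟨hk, rfl | hk'⟩
    exacts [absurd hk hj, hk']
  obtain ⟨u, -, hu⟩ := h3
  have h4 : c i (v j) = 0 := by
    have := coord_eq_zero_of_mem_span_erase hc' hi hsub (u := u)
    rw [← hu, map_add, hsum i hi] at this
    simpa using this
  have h5 : ∑ k ∈ insert j (I.erase i), (if k = j then 1 else -c k (v j)) • v k = 0 := by
    rw [Finset.sum_insert hj']
    have : ∑ k ∈ I.erase i, (if k = j then 1 else -c k (v j)) • v k
        = -∑ k ∈ I, c k (v j) • v k := by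
      rw [← Finset.add_sum_erase I _ hi, h4, zero_smul, zero_add, ← Finset.sum_neg_distrib]
      exact Finset.sum_congr rfl fun k hk => by rw [if_neg (show k ≠ j from fun h => hj' (h ▸ hk)), neg_smul]
    rw [this, hc]
    simp
  have h6 := linearIndepOn_finset_iff.1 hli _ h5 j (Finset.mem_insert_self _ _)
  simp at h6

variable {W ι : Type*} [NormedAddCommGroup W] [NormedSpace ℝ W] [FiniteDimensional ℝ W]

/-- A nonempty open set is not covered by finitely many proper subspaces. -/
theorem exists_mem_open_forall_notMem {O : Set W} (hO : IsOpen O) (hne : O.Nonempty)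
    {S : Set (Submodule ℝ W)} (hS : S.Finite) (hT : ∀ p ∈ S, p ≠ ⊤) :
    ∃ y ∈ O, ∀ p ∈ S, y ∉ p := by
  have : Dense (⋂ p ∈ S, ((p : Set W))ᶜ) := by
    refine dense_biInter_of_isOpen
      (fun p _ => (p.closed_of_finiteDimensional).isOpen_compl) hS.countable fun p hp => ?_
    rw [← interior_eq_empty_iff_dense_compl]
    by_contra h
    exact hT p hp (p.eq_top_of_nonempty_interior' (Set.nonempty_iff_ne_empty.2 h))
  obtain ⟨y, hy, hy'⟩ := this.inter_open_nonempty O hO hne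
  exact ⟨y, hy, by simpa using hy'⟩

/-- The generators form a basis. Its coordinate forms are indexed by all of `ι`, with the value `0`
off `I`, so that cones with different index sets can be compared without subtypes. -/
theorem exists_coord {v : ι → W} {I : Finset ι} (h : LinearIndependent ℝ (fun i : I => v i))
    (hc : I.card = finrank ℝ W) :
    ∃ c : ι → W →ₗ[ℝ] ℝ, (∀ x, ∑ i ∈ I, c i x • v i = x) ∧
      ∀ u : ι → ℝ, ∀ i ∈ I, c i (∑ k ∈ I, u k • v k) = u i := by
  classical
  let b : Basis I ℝ W := Basis.mk h (h.span_eq_top_of_card_eq_finrank' (by simpa using hc)).ge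
  have hb : ∀ i : I, b i = v i := fun i => by simp [b]
  refine ⟨fun i => if hi : i ∈ I then b.coord ⟨i, hi⟩ else 0, fun x => ?_, fun u i hi => ?_⟩
  · conv_rhs => rw [← b.sum_repr x]
    rw [← Finset.sum_coe_sort I]
    exact Finset.sum_congr rfl fun i _ => by simp [hb]
  · have : ∑ k ∈ I, u k • v k = ∑ k : I, u k • b k := by
      rw [← Finset.sum_coe_sort I]
      exact Finset.sum_congr rfl fun i _ => by simp [hb]
    rw [this]
    simp only [hi, dif_pos, Basis.coord_apply]
    rw [b.repr_sum_self]

theorem isClosed_coneSpan {v : ι → W} {I : Finset ι}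
    (h : LinearIndependent ℝ (fun i : I => v i)) (hI : I.card = finrank ℝ W) :
    IsClosed (coneSpan v I) := by
  obtain ⟨c, hc, hc'⟩ := exists_coord h hI
  have : coneSpan v I = ⋂ i ∈ I, {x | 0 ≤ c i x} := by
    ext x
    simp [mem_coneSpan_iff_coord hc hc']
  rw [this]
  exact isClosed_biInter fun i _ =>
    isClosed_le continuous_const (c i).continuous_of_finiteDimensional

/-- Near a relative interior point of the common facet, two cones on different sides of it cover
the whole space. -/
theorem eventually_mem_coneSpan_or [DecidableEq ι] {v : ι → W} {I : Finset ι}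
    {c : ι → W →ₗ[ℝ] ℝ} (hc : ∀ x, ∑ i ∈ I, c i x • v i = x)
    (hc' : ∀ u : ι → ℝ, ∀ i ∈ I, c i (∑ k ∈ I, u k • v k) = u i)
    {i j : ι} (hi : i ∈ I) (hj : j ∉ I) (hneg : c i (v j) < 0) {z : W}
    (hz : ∀ k ∈ I.erase i, 0 < c k z) (hzi : c i z = 0) :
    ∀ᶠ x in 𝓝 z, x ∈ coneSpan v I ∨ x ∈ coneSpan v (insert j (I.erase i)) := by
  have hj' : j ∉ I.erase i := fun h => hj (Finset.mem_of_mem_erase h)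
  have hcont : ∀ k, Continuous (c k) := fun k => (c k).continuous_of_finiteDimensional
  have e1 : ∀ᶠ x in 𝓝 z, ∀ k ∈ I.erase i, 0 < c k x :=
    (Finset.eventually_all _).2 fun k hk =>
      (hcont k).continuousAt.eventually_const_lt (hz k hk)
  -- These are the coordinates of `x` once `v j` replaces `v i`: subtracting `(c i x / c i (v j)) •
  -- v j` kills the `i`-th one. At `z` the correction is zero, so positivity persists nearby.
  have e2 : ∀ᶠ x in 𝓝 z, ∀ k ∈ I.erase i, 0 < c k x - c i x / c i (v j) * c k (v j) :=
    (Finset.eventually_all _).2 fun k hk => by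
      have : Continuous fun x => c k x - c i x / c i (v j) * c k (v j) :=
        (hcont k).sub (((hcont i).div_const _).mul_const _)
      refine this.continuousAt.eventually_const_lt ?_
      simpa [hzi] using hz k hk
  filter_upwards [e1, e2] with x h1 h2
  rcases le_or_gt 0 (c i x) with h | h
  · left
    rw [mem_coneSpan_iff_coord hc hc']
    intro k hk
    by_cases hki : k = i
    · rwa [hki]
    · exact (h1 k (Finset.mem_erase.2 ⟨hki, hk⟩)).le
  · right
    set r := c i x / c i (v j) with hr
    have hr0 : 0 < r := div_pos_of_neg_of_neg h hneg
    have hx : x = ∑ k ∈ insert j (I.erase i), (if k = j then r else c k x - r * c k (v j)) • v k := by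
      rw [Finset.sum_insert hj', if_pos rfl]
      have : ∑ k ∈ I.erase i, (if k = j then r else c k x - r * c k (v j)) • v k
          = x - r • v j := by
        have hzero : c i x - r * c i (v j) = 0 := by
          rw [hr, div_mul_cancel₀ _ hneg.ne, sub_self]
        conv_rhs => rw [← hc x, ← hc (v j)]
        rw [Finset.smul_sum, ← Finset.sum_sub_distrib, ← Finset.add_sum_erase I _ hi, smul_smul,
          ← sub_smul, hzero, zero_smul, zero_add]
        refine Finset.sum_congr rfl fun k hk => ?_
        rw [if_neg (show k ≠ j from fun h => hj' (h ▸ hk)), smul_smul, ← sub_smul]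
      rw [this]
      abel
    rw [hx]
    refine mem_coneSpan_of_nonneg fun k hk => ?_
    split_ifs with hkj
    · exact hr0.le
    · exact (h2 k ((Finset.mem_insert.1 hk).resolve_left hkj)).le

/-- A nonempty family of full-dimensional simplicial cones, any two of which meet along a common
face and such that every facet is shared by two cones, covers the space. -/
theorem exists_mem_coneSpan_of_exchange [DecidableEq ι] [Finite ι] {v : ι → W}
    {F : Set (Finset ι)} (hne : F.Nonempty) (hcard : ∀ I ∈ F, I.card = finrank ℝ W)
    (hli : ∀ I ∈ F, LinearIndependent ℝ (fun i : I => v i))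
    (meet : ∀ I ∈ F, ∀ J ∈ F, ∀ x ∈ coneSpan v I, x ∈ coneSpan v J → x ∈ coneSpan v (I ∩ J))
    (sep : ∀ I ∈ F, ∀ i ∈ I, ∃ j ∉ I, insert j (I.erase i) ∈ F) (w : W) :
    ∃ I ∈ F, w ∈ coneSpan v I := by
  have hF : F.Finite := Set.toFinite F
  obtain ⟨I₀, hI₀⟩ := hne
  obtain ⟨c₀, hc₀, hc₀'⟩ := exists_coord (hli I₀ hI₀) (hcard I₀ hI₀)
  let O : Set W := ⋂ i ∈ I₀, {x | 0 < c₀ i x}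
  have hO : IsOpen O := isOpen_biInter_finset fun i _ =>
    isOpen_lt continuous_const (c₀ i).continuous_of_finiteDimensional
  have hOne : O.Nonempty := by
    refine ⟨∑ k ∈ I₀, (1 : ℝ) • v k, ?_⟩
    simp only [O, Set.mem_iInter, Set.mem_ofPred_eq]
    intro i hi
    rw [hc₀' (fun _ => 1) i hi]
    exact zero_lt_one
  -- A start `y` outside these subspaces ensures that the segment from `y` to `w` meets no face of
  -- codimension at least two before reaching `w`.
  let S : Set (Submodule ℝ W) := (fun K : Finset ι => Submodule.span ℝ (insert w (v '' K))) ''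
    {K | K.card + 2 ≤ finrank ℝ W}
  have hS : S.Finite := (Set.toFinite _).image _
  have hST : ∀ p ∈ S, p ≠ ⊤ := by
    classical
    rintro _ ⟨K, hK, rfl⟩ htop
    beta_reduce at htop
    have h1 := finrank_span_finset_le_card (R := ℝ) (insert w (K.image v))
    have h2 : ((insert w (K.image v) : Finset W) : Set W) = insert w (v '' K) := by
      simp
    rw [h2, Set.finrank, htop, finrank_top] at h1
    have h3 := Finset.card_insert_le w (K.image v)
    have h4 := Finset.card_image_le (s := K) (f := v)
    have h5 : K.card + 2 ≤ finrank ℝ W := hK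
    omega
  obtain ⟨y, hy, hyS⟩ := exists_mem_open_forall_notMem hO hOne hS hST
  let x : ℝ → W := fun t => y + t • (w - y)
  have hx : Continuous x := by fun_prop
  let U : Set W := ⋃ I ∈ F, coneSpan v I
  have hU : IsClosed U :=
    hF.isClosed_biUnion fun I hI => isClosed_coneSpan (hli I hI) (hcard I hI)
  have hsub : Set.Icc (0 : ℝ) 1 ⊆ x ⁻¹' U := by
    -- Continuous induction: the covered times form a closed set containing `0`, and each covered `t
    -- < 1` has a covered neighbourhood.
    refine IsClosed.Icc_subset_of_forall_mem_nhdsWithin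
      ((hU.preimage hx).inter isClosed_Icc) ?_ ?_
    · simp only [Set.mem_preimage, U, Set.mem_iUnion]
      refine ⟨I₀, hI₀, ?_⟩
      rw [mem_coneSpan_iff_coord hc₀ hc₀']
      intro i hi
      have : 0 < c₀ i y := by
        simp only [O, Set.mem_iInter, Set.mem_ofPred_eq] at hy
        exact hy i hi
      simpa [x] using this.le
    · rintro t ⟨htU, ht0, ht1⟩
      refine mem_nhdsWithin_of_mem_nhds (hx.continuousAt.preimage_mem_nhds ?_)
      simp only [Set.mem_preimage, U, Set.mem_iUnion] at htU
      obtain ⟨I, hI, hxI⟩ := htU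
      obtain ⟨c, hc, hc'⟩ := exists_coord (hli I hI) (hcard I hI)
      have hnn := (mem_coneSpan_iff_coord hc hc' _).1 hxI
      -- Two vanishing coordinates would put `x t` in the span of the remaining generators; since `t
      -- < 1`, solving for `y` puts it in a forbidden subspace.
      have huniq : ∀ i ∈ I, ∀ j ∈ I, i ≠ j → c i (x t) = 0 → c j (x t) ≠ 0 := by
        intro i hi j hj hij hi0 hj0
        have hji : j ∈ I.erase i := Finset.mem_erase.2 ⟨hij.symm, hj⟩
        refine hyS _ ⟨(I.erase i).erase j, ?_, rfl⟩ ?_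
        · have h1 := Finset.card_erase_add_one hji
          have h2 := Finset.card_erase_add_one hi
          have h3 := hcard I hI
          change _ + 2 ≤ _
          omega
        · have hw : w ∈ Submodule.span ℝ (insert w (v '' ((I.erase i).erase j : Finset ι))) :=
            Submodule.subset_span (Set.mem_insert _ _)
          have hxt : x t ∈ Submodule.span ℝ (insert w (v '' ((I.erase i).erase j : Finset ι))) := by
            rw [← hc (x t), ← Finset.add_sum_erase I _ hi, hi0, zero_smul, zero_add,
              ← Finset.add_sum_erase _ _ hji, hj0, zero_smul, zero_add]
            exact Submodule.sum_mem _ fun k hk => Submodule.smul_mem _ _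
              (Submodule.subset_span (Set.mem_insert_of_mem _ ⟨k, hk, rfl⟩))
          have ht : (1 - t) ≠ 0 := by linarith
          have : y = (1 - t)⁻¹ • (x t - t • w) := by
            rw [eq_inv_smul_iff₀ ht]
            simp only [x, smul_sub, sub_smul, one_smul]
            abel
          rw [this]
          exact Submodule.smul_mem _ _ (Submodule.sub_mem _ hxt (Submodule.smul_mem _ _ hw))
      by_cases hpos : ∀ i ∈ I, c i (x t) ≠ 0
      · have : ∀ᶠ z in 𝓝 (x t), ∀ i ∈ I, 0 < c i z :=
          (Finset.eventually_all _).2 fun i hi =>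
            ((c i).continuous_of_finiteDimensional).continuousAt.eventually_const_lt
              ((hnn i hi).lt_of_ne (hpos i hi).symm)
        filter_upwards [this] with z hz
        exact Set.mem_biUnion hI
          ((mem_coneSpan_iff_coord hc hc' _).2 fun i hi => (hz i hi).le)
      · push Not at hpos
        obtain ⟨i, hi, hi0⟩ := hpos
        obtain ⟨j, hj, hJ⟩ := sep I hI i hi
        have hneg := coord_neg_of_inter_facet hc hc' hi hj (hli _ hJ) (meet I hI _ hJ)
        have := eventually_mem_coneSpan_or hc hc' hi hj hneg (z := x t) (fun k hk =>
          (hnn k (Finset.mem_of_mem_erase hk)).lt_of_ne (huniq i hi k (Finset.mem_of_mem_erase hk)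
            (Finset.ne_of_mem_erase hk).symm hi0).symm) hi0
        filter_upwards [this] with z hz
        rcases hz with hz | hz
        exacts [Set.mem_biUnion hI hz, Set.mem_biUnion hJ hz]
  have h1 := hsub (Set.right_mem_Icc.2 zero_le_one)
  simpa [x, U] using h1

/-- If finitely many simplicial cones cover the space, then so do the full-dimensional ones. -/
theorem exists_mem_coneSpan_card_eq_finrank [Finite ι] {v : ι → W} {K : Set (Finset ι)}
    (hli : ∀ I ∈ K, LinearIndependent ℝ (fun i : I => v i))
    (hcov : ∀ w, ∃ I ∈ K, w ∈ coneSpan v I) (w : W) :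
    ∃ I ∈ K, I.card = finrank ℝ W ∧ w ∈ coneSpan v I := by
  classical
  by_contra! hw
  let U : Set W := ⋃ I ∈ {I | I ∈ K ∧ I.card = finrank ℝ W}, coneSpan v I
  have hU : IsClosed U :=
    (Set.toFinite _).isClosed_biUnion fun I hI => isClosed_coneSpan (hli I hI.1) hI.2
  have hwU : w ∈ Uᶜ := by
    simp only [U, Set.mem_compl_iff, Set.mem_iUnion, Set.mem_ofPred_eq, not_exists]
    exact fun I hI => hw I hI.1 hI.2
  -- The lower-dimensional cones lie in finitely many proper subspaces, which cannot fill the open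
  -- complement of the full-dimensional cones.
  let S : Set (Submodule ℝ W) := (fun I : Finset ι => Submodule.span ℝ (v '' I)) ''
    {I | I.card < finrank ℝ W}
  have hST : ∀ p ∈ S, p ≠ ⊤ := by
    rintro _ ⟨I, hI, rfl⟩ htop
    beta_reduce at htop
    have h1 := finrank_span_finset_le_card (R := ℝ) (I.image v)
    rw [Finset.coe_image, Set.finrank, htop, finrank_top] at h1
    have h4 := Finset.card_image_le (s := I) (f := v)
    have h5 : I.card < finrank ℝ W := hI
    omega
  obtain ⟨y, hy, hyS⟩ := exists_mem_open_forall_notMem hU.isOpen_compl ⟨w, hwU⟩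
    ((Set.toFinite _).image _ : S.Finite) hST
  obtain ⟨I, hI, hyI⟩ := hcov y
  have hle : I.card ≤ finrank ℝ W := by
    simpa using (hli I hI).fintype_card_le_finrank
  rcases hle.lt_or_eq with hlt | heq
  · obtain ⟨u, -, rfl⟩ := hyI
    exact hyS _ ⟨I, hlt, rfl⟩ (Submodule.sum_mem _ fun k hk =>
      Submodule.smul_mem _ _ (Submodule.subset_span ⟨k, hk, rfl⟩))
  · exact hy (Set.mem_biUnion ⟨hI, heq⟩ hyI)

/-- In a complete simplicial fan, every facet of a full-dimensional cone is a facet of another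
full-dimensional cone. -/
theorem exists_exchange_of_forall_mem_coneSpan [DecidableEq ι] [Finite ι] {v : ι → W}
    {F : Set (Finset ι)} (hcard : ∀ I ∈ F, I.card = finrank ℝ W)
    (hli : ∀ I ∈ F, LinearIndependent ℝ (fun i : I => v i))
    (meet : ∀ I ∈ F, ∀ J ∈ F, ∀ x ∈ coneSpan v I, x ∈ coneSpan v J → x ∈ coneSpan v (I ∩ J))
    (hcov : ∀ w, ∃ I ∈ F, w ∈ coneSpan v I) {I : Finset ι} (hI : I ∈ F) {i : ι} (hi : i ∈ I) :
    ∃ j ∉ I, insert j (I.erase i) ∈ F := by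
  obtain ⟨c, hc, hc'⟩ := exists_coord (hli I hI) (hcard I hI)
  -- This path starts in the relative interior of the facet opposite `i` and leaves the cone of `I`
  -- for `t > 0`.
  let x : ℝ → W := fun t => ∑ k ∈ I, (if k = i then -t else 1) • v k
  have hx : Continuous x := by
    refine continuous_finsetSum _ fun k _ => Continuous.smul ?_ continuous_const
    split_ifs <;> fun_prop
  have hcx : ∀ t, ∀ k ∈ I, c k (x t) = if k = i then -t else 1 := fun t k hk => hc' _ k hk
  -- Since there are finitely many cones, one of them contains `x t` for arbitrarily small `t > 0`,
  -- hence also `x 0` by closedness.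
  obtain ⟨J, hJ, hfreq⟩ : ∃ J ∈ F, ∃ᶠ t in 𝓝[>] (0 : ℝ), x t ∈ coneSpan v J := by
    by_contra! h
    have h1 : ∀ᶠ t in 𝓝[>] (0 : ℝ), ∀ J ∈ F, x t ∉ coneSpan v J :=
      ((Set.toFinite F).eventually_all).2 h
    obtain ⟨t, ht⟩ := h1.exists
    obtain ⟨J, hJ, hJ'⟩ := hcov (x t)
    exact ht J hJ hJ'
  have hJI : J ≠ I := by
    rintro rfl
    obtain ⟨t, ht, ht0⟩ := (hfreq.and_eventually self_mem_nhdsWithin).exists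
    have h1 := (mem_coneSpan_iff_coord hc hc' _).1 ht i hi
    rw [hcx t i hi, if_pos rfl] at h1
    have : 0 < t := ht0
    linarith
  have hx0 : x 0 ∈ coneSpan v J := by
    have hcl := isClosed_coneSpan (hli J hJ) (hcard J hJ)
    exact hcl.mem_of_frequently_of_tendsto hfreq
      (hx.continuousAt.tendsto.mono_left nhdsWithin_le_nhds)
  have hx0I : x 0 ∈ coneSpan v I := by
    refine mem_coneSpan_of_nonneg fun k _ => ?_
    split_ifs <;> simp
  -- The point `x 0` lies in the cone of `I ∩ J`, yet its coordinates on `I.erase i` are all `1`.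
  have hsub : I.erase i ⊆ J := by
    intro k hk
    by_contra hkJ
    obtain ⟨u, -, hu⟩ := meet I hI J hJ _ hx0I hx0
    have hkI := Finset.mem_of_mem_erase hk
    have h1 := hcx 0 k hkI
    rw [hu, if_neg (Finset.ne_of_mem_erase hk),
      coord_eq_zero_of_mem_span_erase hc' hkI] at h1
    · exact zero_ne_one h1
    · intro l hl
      rw [Finset.mem_inter] at hl
      exact Finset.mem_erase.2 ⟨fun h => hkJ (h ▸ hl.2), hl.1⟩
  have hc1 : (I.erase i).card + 1 = J.card := by
    rw [Finset.card_erase_add_one hi, hcard I hI, hcard J hJ]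
  obtain ⟨j, hj⟩ : ∃ j, j ∈ J \ I.erase i := by
    rw [← Finset.Nonempty, ← Finset.card_pos, Finset.card_sdiff_of_subset hsub]
    omega
  rw [Finset.mem_sdiff] at hj
  have hJeq : insert j (I.erase i) = J := by
    refine Finset.eq_of_subset_of_card_le (Finset.insert_subset hj.1 hsub) ?_
    rw [Finset.card_insert_of_notMem hj.2]
    omega
  refine ⟨j, fun hjI => hJI ?_, hJeq ▸ hJ⟩
  have hji : j = i := by
    by_contra h
    exact hj.2 (Finset.mem_erase.2 ⟨h, hjI⟩)
  rw [← hJeq, hji, Finset.insert_erase hi]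

end ConeGeometry

end LVMB

namespace LVMB

theorem mem_coneSpan_iff_support {V ι : Type*} [AddCommGroup V] [Module ℝ V] [Fintype ι]
    {v : ι → V} {S : Finset ι} {x : V} :
    x ∈ coneSpan v S ↔
      ∃ u : ι → ℝ, (∀ i, 0 ≤ u i) ∧ (∀ i ∉ S, u i = 0) ∧ x = ∑ i, u i • v i := by
  classical
  constructor
  · rintro ⟨u, hu, rfl⟩
    refine ⟨fun i => if i ∈ S then u i else 0, fun i => ?_, fun i hi => if_neg hi, ?_⟩
    · dsimp only
      split_ifs
      exacts [hu i, le_rfl]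
    · simp [ite_smul, Finset.sum_ite_mem]
  · rintro ⟨u, hu, h0, rfl⟩
    refine ⟨u, hu, ?_⟩
    exact (Finset.sum_subset (Finset.subset_univ S) fun i _ hi => by simp [h0 i hi]).symm

/-- A linear map which is injective on a simplicial cone preserves the linear independence of its
generators. -/
theorem linearIndependent_of_injOn_coneSpan {V W ι : Type*} [AddCommGroup V] [Module ℝ V]
    [AddCommGroup W] [Module ℝ W] {f : V →ₗ[ℝ] W} {v : ι → V} {I : Finset ι}
    (hf : Set.InjOn f (coneSpan v I)) (hv : LinearIndependent ℝ (fun i : I => v i)) :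
    LinearIndependent ℝ (fun i : I => f (v i)) := by
  refine (linearIndepOn_finset_iff (v := fun i => f (v i))).2 fun g hg =>
    linearIndepOn_finset_iff.1 hv g ?_
  -- Positive and negative parts turn a relation among the images into two points of the cone with
  -- the same image.
  have hsub : ∑ i ∈ I, g i • v i = ∑ i ∈ I, (g i)⁺ • v i - ∑ i ∈ I, (g i)⁻ • v i := by
    rw [← Finset.sum_sub_distrib]
    exact Finset.sum_congr rfl fun i _ => by rw [← sub_smul, posPart_sub_negPart]
  rw [hsub, sub_eq_zero]
  refine hf (mem_coneSpan_of_nonneg fun i _ => posPart_nonneg _)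
    (mem_coneSpan_of_nonneg fun i _ => negPart_nonneg _) ?_
  rw [← sub_eq_zero, ← map_sub, ← hsub, map_sum]
  simpa using hg

/-! ### The fan of projective space in homogeneous coefficients. -/

section Ray

variable {n : ℕ}

theorem sum_smul_ray_apply (u : Fin (n + 1) → ℝ) (j : Fin n) :
    (∑ i, u i • ray n i) j = u j.succ - u 0 := by
  have h1 : (∑ i : Fin n, Pi.single i (1 : ℝ) : Fin n → ℝ) j = 1 := by
    simp [Finset.sum_apply, Pi.single_apply]
  have h2 : ∑ i : Fin n, u i.succ * (Pi.single i (1 : ℝ) : Fin n → ℝ) j = u j.succ := by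
    simp [Pi.single_apply]
  rw [Fin.sum_univ_succ, Pi.add_apply, Finset.sum_apply]
  simp only [ray, Fin.cons_zero, Fin.cons_succ, Pi.smul_apply, Pi.neg_apply, smul_eq_mul, h1, h2]
  ring

theorem exists_sum_smul_ray (x : Fin n → ℝ) : ∃ u : Fin (n + 1) → ℝ, x = ∑ i, u i • ray n i :=
  ⟨Fin.cons 0 x, by ext j; rw [sum_smul_ray_apply]; simp⟩

theorem sum_smul_ray_eq_iff {u v : Fin (n + 1) → ℝ} :
    ∑ i, u i • ray n i = ∑ i, v i • ray n i ↔ ∃ c, ∀ i, u i = v i + c := by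
  constructor
  · intro h
    refine ⟨u 0 - v 0, fun i => ?_⟩
    induction i using Fin.cases with
    | zero => ring
    | succ j =>
      have := congrFun h j
      rw [sum_smul_ray_apply, sum_smul_ray_apply] at this
      linarith
  · rintro ⟨c, hc⟩
    ext j
    rw [sum_smul_ray_apply, sum_smul_ray_apply, hc, hc 0]
    ring

/-- The two vectors differ by a constant `c`; a zero of `u` gives `c ≤ 0` and a zero of `v` gives `c
≥ 0`. Points of cones on proper subsets thus have unique normalised coefficients. -/
theorem eq_of_sum_smul_ray_eq {u v : Fin (n + 1) → ℝ} (hu : ∀ i, 0 ≤ u i) (hv : ∀ i, 0 ≤ v i)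
    (hu0 : ∃ i, u i = 0) (hv0 : ∃ i, v i = 0)
    (h : ∑ i, u i • ray n i = ∑ i, v i • ray n i) : u = v := by
  obtain ⟨c, hc⟩ := sum_smul_ray_eq_iff.1 h
  obtain ⟨i, hi⟩ := hu0
  obtain ⟨j, hj⟩ := hv0
  have h1 := hc i
  have h2 := hc j
  have h3 := hv i
  have h4 := hu j
  ext k
  have := hc k
  linarith

theorem exists_notMem_of_ne_univ {J : Finset (Fin (n + 1))} (hJ : J ≠ Finset.univ) :
    ∃ i, i ∉ J := by
  by_contra! h
  exact hJ (Finset.eq_univ_iff_forall.2 h)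

theorem mem_coneSpan_ray_inter {I J : Finset (Fin (n + 1))} (hI : I ≠ Finset.univ)
    (hJ : J ≠ Finset.univ) {x : Fin n → ℝ} (hxI : x ∈ coneSpan (ray n) I)
    (hxJ : x ∈ coneSpan (ray n) J) : x ∈ coneSpan (ray n) (I ∩ J) := by
  rw [mem_coneSpan_iff_support] at *
  obtain ⟨u, hu, hu0, rfl⟩ := hxI
  obtain ⟨v, hv, hv0, h⟩ := hxJ
  obtain ⟨i, hi⟩ := exists_notMem_of_ne_univ hI
  obtain ⟨j, hj⟩ := exists_notMem_of_ne_univ hJ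
  obtain rfl := eq_of_sum_smul_ray_eq hu hv ⟨i, hu0 i hi⟩ ⟨j, hv0 j hj⟩ h
  refine ⟨u, hu, fun k hk => ?_, rfl⟩
  rw [Finset.mem_inter, not_and_or] at hk
  exact hk.elim (hu0 k) (hv0 k)

theorem coneSpan_ray_inter {I J : Finset (Fin (n + 1))} (hI : I ≠ Finset.univ)
    (hJ : J ≠ Finset.univ) :
    coneSpan (ray n) I ∩ coneSpan (ray n) J = coneSpan (ray n) (I ∩ J) :=
  Set.Subset.antisymm (fun _ hx => mem_coneSpan_ray_inter hI hJ hx.1 hx.2)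
    (Set.subset_inter (coneSpan_mono Finset.inter_subset_left)
      (coneSpan_mono Finset.inter_subset_right))

theorem linearIndependent_ray {I : Finset (Fin (n + 1))} (hI : I ≠ Finset.univ) :
    LinearIndependent ℝ (fun i : I => ray n i) := by
  obtain ⟨k, hk⟩ := exists_notMem_of_ne_univ hI
  refine linearIndepOn_finset_iff.2 fun g hg i hi => ?_
  have h : ∑ i, (if i ∈ I then g i else 0) • ray n i = ∑ i, (0 : Fin (n + 1) → ℝ) i • ray n i := by
    simpa [ite_smul, Finset.sum_ite_mem] using hg
  obtain ⟨c, hc⟩ := sum_smul_ray_eq_iff.1 h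
  have h1 := hc k
  have h2 := hc i
  simp only [if_neg hk, if_pos hi, Pi.zero_apply, zero_add] at h1 h2
  rw [h2, h1]

/-- The normalised coefficients of this relative interior point are the indicator of `J`, so any
cone containing it uses every ray of `J`. -/
theorem subset_of_sum_smul_ray_mem {I J : Finset (Fin (n + 1))} (hI : I ≠ Finset.univ)
    (hJ : J ≠ Finset.univ) (h : ∑ i ∈ J, (1 : ℝ) • ray n i ∈ coneSpan (ray n) I) : J ⊆ I := by
  obtain ⟨i, hi⟩ := exists_notMem_of_ne_univ hI
  obtain ⟨j, hj⟩ := exists_notMem_of_ne_univ hJ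
  obtain ⟨v, hv, hv0, h⟩ := mem_coneSpan_iff_support.1 h
  have h' : ∑ i, (if i ∈ J then 1 else 0 : ℝ) • ray n i = ∑ i, v i • ray n i := by
    rw [← h]
    simp [ite_smul, Finset.sum_ite_mem]
  have huv := eq_of_sum_smul_ray_eq (fun i => by split_ifs <;> simp) hv ⟨j, if_neg hj⟩
    ⟨i, hv0 i hi⟩ h'
  intro k hk
  by_contra hkI
  have := congrFun huv k
  rw [hv0 k hkI] at this
  simp [hk] at this

theorem coneSpan_ray_subset_iff {I J : Finset (Fin (n + 1))} (hI : I ≠ Finset.univ)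
    (hJ : J ≠ Finset.univ) : coneSpan (ray n) J ⊆ coneSpan (ray n) I ↔ J ⊆ I :=
  ⟨fun h => subset_of_sum_smul_ray_mem hI hJ
    (h (mem_coneSpan_of_nonneg fun _ _ => zero_le_one)), coneSpan_mono⟩

theorem coneSpan_ray_injective {I J : Finset (Fin (n + 1))} (hI : I ≠ Finset.univ)
    (hJ : J ≠ Finset.univ) (h : coneSpan (ray n) J = coneSpan (ray n) I) : J = I :=
  ((coneSpan_ray_subset_iff hI hJ).1 h.subset).antisymm
    ((coneSpan_ray_subset_iff hJ hI).1 h.superset)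

theorem ne_univ_of_subset {I J : Finset (Fin (n + 1))} (hI : I ≠ Finset.univ) (h : J ⊆ I) :
    J ≠ Finset.univ := by
  rintro rfl
  exact hI (Finset.univ_subset_iff.1 h)

/-- A form nonnegative on the generators vanishes on a nonnegative combination only if it vanishes
on each generator actually used. Conversely, any `n` of the rays form a basis, so the form with
value `0` on `J` and `1` on the other basis rays exists. -/
theorem isFace_coneSpan_ray_iff {I : Finset (Fin (n + 1))} (hI : I ≠ Finset.univ)
    {τ : Set (Fin n → ℝ)} :
    IsFace τ (coneSpan (ray n) I) ↔ ∃ J ⊆ I, τ = coneSpan (ray n) J := by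
  constructor
  · rintro ⟨φ, hφ, rfl⟩
    have hray : ∀ i ∈ I, 0 ≤ φ (ray n i) := fun i hi => by
      refine hφ _ ?_
      have := mem_coneSpan_of_nonneg (v := ray n) (S := {i}) (c := fun _ => 1) (by simp)
      exact coneSpan_mono (Finset.singleton_subset_iff.2 hi) (by simpa using this)
    refine ⟨I.filter fun i => φ (ray n i) = 0, Finset.filter_subset _ _, ?_⟩
    ext x
    constructor
    · rintro ⟨⟨u, hu, rfl⟩, h0⟩
      simp only [map_sum, map_smul, smul_eq_mul] at h0
      rw [Finset.sum_eq_zero_iff_of_nonneg fun i hi => mul_nonneg (hu i) (hray i hi)] at h0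
      refine ⟨u, hu, ?_⟩
      rw [Finset.sum_filter]
      refine Finset.sum_congr rfl fun i hi => ?_
      split_ifs with h
      · rfl
      · rw [(mul_eq_zero.1 (h0 i hi)).resolve_right h, zero_smul]
    · intro hx
      refine ⟨coneSpan_mono (Finset.filter_subset _ _) hx, ?_⟩
      obtain ⟨u, -, rfl⟩ := hx
      rw [map_sum]
      refine Finset.sum_eq_zero fun i hi => ?_
      rw [map_smul, (Finset.mem_filter.1 hi).2, smul_zero]
  · rintro ⟨J, hJ, rfl⟩
    obtain ⟨k, hk⟩ := exists_notMem_of_ne_univ hI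
    let b := linearIndependent_ray (n := n) (I := Finset.univ.erase k) (by
      intro h
      have := h ▸ Finset.mem_univ k
      simp at this)
    let c : Module.Basis ((Finset.univ.erase k : Finset (Fin (n + 1)))) ℝ (Fin n → ℝ) :=
      Module.Basis.mk b (b.span_eq_top_of_card_eq_finrank' (by simp)).ge
    let φ : Module.Dual ℝ (Fin n → ℝ) := c.constr ℝ fun i => if (i : Fin (n + 1)) ∈ J then 0 else 1
    have hφ : ∀ i ∈ I, φ (ray n i) = if i ∈ J then 0 else 1 := by
      intro i hi
      have hik : i ∈ Finset.univ.erase k := by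
        rw [Finset.mem_erase]
        exact ⟨fun h => hk (h ▸ hi), Finset.mem_univ _⟩
      have := c.constr_basis ℝ (fun i => if (i : Fin (n + 1)) ∈ J then (0 : ℝ) else 1) ⟨i, hik⟩
      rw [show c ⟨i, hik⟩ = ray n i by simp [c]] at this
      exact this
    have hsum : ∀ u : Fin (n + 1) → ℝ,
        φ (∑ i ∈ I, u i • ray n i) = ∑ i ∈ I, if i ∈ J then 0 else u i := by
      intro u
      rw [map_sum]
      refine Finset.sum_congr rfl fun i hi => ?_
      rw [map_smul, hφ i hi]
      simp
    have hterm : ∀ u : Fin (n + 1) → ℝ, (∀ i, 0 ≤ u i) → ∀ i ∈ I,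
        0 ≤ if i ∈ J then 0 else u i := by
      intro u hu i _
      split_ifs
      exacts [le_rfl, hu i]
    refine ⟨φ, ?_, ?_⟩
    · rintro _ ⟨u, hu, rfl⟩
      rw [hsum]
      exact Finset.sum_nonneg (hterm u hu)
    · ext x
      constructor
      · intro hx
        refine ⟨coneSpan_mono hJ hx, ?_⟩
        obtain ⟨u, -, rfl⟩ := hx
        rw [map_sum]
        refine Finset.sum_eq_zero fun i hi => ?_
        rw [map_smul, hφ i (hJ hi), if_pos hi, smul_zero]
      · rintro ⟨⟨u, hu, rfl⟩, h0⟩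
        rw [hsum, Finset.sum_eq_zero_iff_of_nonneg (hterm u hu)] at h0
        refine ⟨u, hu, (Finset.sum_subset hJ fun i hi hiJ => ?_).symm⟩
        have := h0 i hi
        rw [if_neg hiJ] at this
        rw [this, zero_smul]

theorem isPolyhedralCone_coneSpan_ray {I : Finset (Fin (n + 1))} (hI : I ≠ Finset.univ) :
    IsPolyhedralCone (coneSpan (ray n) I) := by
  refine ⟨⟨n + 1, fun i => if i ∈ I then ray n i else 0, ?_⟩, ?_⟩
  · simp [coneSpan, smul_ite, Finset.sum_ite_mem]
  · ext x
    constructor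
    · rintro ⟨hx, hx'⟩
      obtain ⟨u, hu, hu0, rfl⟩ := mem_coneSpan_iff_support.1 hx
      obtain ⟨v, hv, hv0, h⟩ := mem_coneSpan_iff_support.1 hx'
      obtain ⟨k, hk⟩ := exists_notMem_of_ne_univ hI
      -- The coefficients of `x` and `-x` add up to a normalised representative of `0`.
      have h1 : ∑ i, (u i + v i) • ray n i = ∑ i, (0 : Fin (n + 1) → ℝ) i • ray n i := by
        simp only [add_smul, Finset.sum_add_distrib, ← h]
        simp
      have h2 := eq_of_sum_smul_ray_eq (fun i => add_nonneg (hu i) (hv i)) (fun i => le_rfl)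
        ⟨k, by rw [hu0 k hk, hv0 k hk, add_zero]⟩ ⟨k, rfl⟩ h1
      refine Finset.sum_eq_zero fun i _ => ?_
      have h3 : u i + v i = 0 := congrFun h2 i
      have h4 := hu i
      have h5 := hv i
      rw [show u i = 0 by linarith, zero_smul]
    · rintro rfl
      have : (0 : Fin n → ℝ) ∈ coneSpan (ray n) I := ⟨0, fun _ => le_rfl, by simp⟩
      exact ⟨this, by simpa using this⟩

/-- A simplicial complex of proper subsets of `{0, ..., n}` defines a fan. -/
theorem isFan_of_simplicial {K : Set (Finset (Fin (n + 1)))} (hK : ∀ I ∈ K, I ≠ Finset.univ)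
    (hsub : ∀ I ∈ K, ∀ J ⊆ I, J ∈ K) : IsFan (coneSpan (ray n) '' K) where
  cone := by
    rintro _ ⟨I, hI, rfl⟩
    exact isPolyhedralCone_coneSpan_ray (hK I hI)
  face_mem := by
    rintro _ ⟨I, hI, rfl⟩ τ hτ
    obtain ⟨J, hJ, rfl⟩ := (isFace_coneSpan_ray_iff (hK I hI)).1 hτ
    exact ⟨J, hsub I hI J hJ, rfl⟩
  inter_face := by
    rintro _ ⟨I, hI, rfl⟩ _ ⟨J, hJ, rfl⟩
    rw [coneSpan_ray_inter (hK I hI) (hK J hJ), isFace_coneSpan_ray_iff (hK I hI),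
      isFace_coneSpan_ray_iff (hK J hJ)]
    exact ⟨⟨_, Finset.inter_subset_left, rfl⟩, ⟨_, Finset.inter_subset_right, rfl⟩⟩

theorem mem_projectiveFan_iff {τ : Set (Fin n → ℝ)} :
    τ ∈ projectiveFan n ↔ ∃ J ≠ Finset.univ, τ = coneSpan (ray n) J := by
  have hne : ∀ i : Fin (n + 1), Finset.univ.erase i ≠ Finset.univ := fun i h => by
    have := h ▸ Finset.mem_univ i
    simp at this
  constructor
  · rintro ⟨i, hi⟩
    obtain ⟨J, hJ, rfl⟩ := (isFace_coneSpan_ray_iff (hne i)).1 hi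
    exact ⟨J, ne_univ_of_subset (hne i) hJ, rfl⟩
  · rintro ⟨J, hJ, rfl⟩
    obtain ⟨i, hi⟩ := exists_notMem_of_ne_univ hJ
    exact ⟨i, (isFace_coneSpan_ray_iff (hne i)).2 ⟨J, fun j hj =>
      Finset.mem_erase.2 ⟨fun h => hi (h ▸ hj), Finset.mem_univ _⟩, rfl⟩⟩

/-- Images of two cones under a projection which is injective on their union meet along the image
of their common face. -/
theorem mem_coneSpan_map_ray_inter {W : Type*} [AddCommGroup W] [Module ℝ W]
    {f : (Fin n → ℝ) →ₗ[ℝ] W} {I J : Finset (Fin (n + 1))} (hI : I ≠ Finset.univ)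
    (hJ : J ≠ Finset.univ) (hf : Set.InjOn f (coneSpan (ray n) I ∪ coneSpan (ray n) J)) {x : W}
    (hxI : x ∈ coneSpan (fun i => f (ray n i)) I) (hxJ : x ∈ coneSpan (fun i => f (ray n i)) J) :
    x ∈ coneSpan (fun i => f (ray n i)) (I ∩ J) := by
  rw [← image_coneSpan] at *
  obtain ⟨y, hy, rfl⟩ := hxI
  obtain ⟨z, hz, h⟩ := hxJ
  obtain rfl := hf (Or.inr hz) (Or.inl hy) h
  exact ⟨z, mem_coneSpan_ray_inter hI hJ hy hz, rfl⟩

end Ray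

end LVMB

/-! ### Real affine functions on the complex dual. -/

namespace LVMB

open Module

/-- A real affine function which is nonpositive on a set and nonnegative at an interior
point vanishes identically. -/
theorem affine_eq_zero_of_interior {V : Type*} [AddCommGroup V] [Module ℝ V] [TopologicalSpace V]
    [ContinuousAdd V] [ContinuousSMul ℝ V] {f : V →ᵃ[ℝ] ℝ} {s : Set V} (hs : ∀ x ∈ s, f x ≤ 0)
    {x : V} (hx : x ∈ interior s) (h0 : 0 ≤ f x) : f = 0 := by
  have hfx : f x = 0 := le_antisymm (hs x (interior_subset hx)) h0
  -- A small step from the interior point in direction `v` stays in `s`, so the linear part is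
  -- nonpositive in every direction, in particular along `v` and `-v`.
  have hlin : ∀ v, f.linear v ≤ 0 := by
    intro v
    have hc : Continuous fun t : ℝ => x + t • v := by fun_prop
    have h1 : ∀ᶠ t in nhds (0 : ℝ), x + t • v ∈ s := by
      refine hc.continuousAt.eventually ?_
      simpa using mem_interior_iff_mem_nhds.1 hx
    obtain ⟨t, ht, ht0⟩ := ((h1.filter_mono nhdsWithin_le_nhds).and
      (self_mem_nhdsWithin (s := Set.Ioi (0 : ℝ)))).exists
    have h2 := hs _ ht
    have h3 : f (x + t • v) = t * f.linear v := by
      have := f.map_vadd x (t • v)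
      rw [vadd_eq_add, vadd_eq_add, add_comm (t • v), map_smul, smul_eq_mul, hfx,
        add_zero] at this
      exact this
    rw [h3] at h2
    have ht0' : 0 < t := ht0
    nlinarith
  ext y
  have h1 := f.map_vadd x (y - x)
  rw [vadd_eq_add, vadd_eq_add, sub_add_cancel, hfx, add_zero] at h1
  have h2 := hlin (y - x)
  have h3 := hlin (-(y - x))
  rw [map_neg] at h3
  rw [h1]
  change _ = (0 : ℝ)
  exact le_antisymm h2 (by linarith)

section Dual

variable {m : ℕ}

theorem finrank_real_strongDual_pi :
    finrank ℝ (StrongDual ℂ (Fin m → ℂ)) = 2 * m := by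
  rw [finrank_real_of_complex,
    ← (LinearMap.toContinuousLinearMap (𝕜 := ℂ) (E := Fin m → ℂ) (F' := ℂ)).finrank_eq]
  simp

theorem smul_re_apply (c : ℝ) (ℓ : StrongDual ℂ (Fin m → ℂ)) (Z : Fin m → ℂ) :
    (ℓ (c • Z)).re = c * (ℓ Z).re := by
  rw [← Complex.coe_smul, map_smul, smul_eq_mul, Complex.re_ofReal_mul]

theorem eq_zero_of_forall_re_eq_zero {Z : Fin m → ℂ}
    (h : ∀ ℓ : StrongDual ℂ (Fin m → ℂ), (ℓ Z).re = 0) : Z = 0 := by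
  ext k
  have h1 := h (ContinuousLinearMap.proj k)
  have h2 := h (Complex.I • ContinuousLinearMap.proj k)
  simp only [smul_apply, ContinuousLinearMap.proj_apply, smul_eq_mul,
    Complex.I_mul_re, neg_eq_zero] at h1 h2
  exact Complex.ext h1 h2

/-- The real pairing `(Z, ℓ) ↦ Re ℓ(Z)`. -/
noncomputable def rePairing (m : ℕ) :
    (Fin m → ℂ) →ₗ[ℝ] Dual ℝ (StrongDual ℂ (Fin m → ℂ)) :=
  LinearMap.mk₂ ℝ (fun Z ℓ => (ℓ Z).re) (by simp) (fun c Z ℓ => smul_re_apply c ℓ Z) (by simp)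
    (by simp)

/-- The pairing is injective in `Z`, and both sides have real dimension `2m`. -/
theorem exists_re_apply_eq (f : Dual ℝ (StrongDual ℂ (Fin m → ℂ))) :
    ∃ Z, ∀ ℓ, f ℓ = (ℓ Z).re := by
  have hinj : Function.Injective (rePairing m) := by
    rw [injective_iff_map_eq_zero]
    exact fun Z hZ => eq_zero_of_forall_re_eq_zero fun ℓ => LinearMap.congr_fun hZ ℓ
  have hfr : finrank ℝ (Fin m → ℂ) = finrank ℝ (Dual ℝ (StrongDual ℂ (Fin m → ℂ))) := by
    rw [Subspace.dual_finrank_eq, finrank_real_strongDual_pi, finrank_real_of_complex]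
    simp
  obtain ⟨Z, rfl⟩ := (LinearMap.injective_iff_surjective_of_finrank_eq_finrank hfr).1 hinj f
  exact ⟨Z, fun ℓ => rfl⟩

/-- The real affine function `ℓ ↦ Re ℓ(Z) + c`. -/
noncomputable def reAffine (Z : Fin m → ℂ) (c : ℝ) : StrongDual ℂ (Fin m → ℂ) →ᵃ[ℝ] ℝ :=
  (rePairing m Z).toAffineMap + AffineMap.const ℝ _ c

@[simp]
theorem reAffine_apply (Z : Fin m → ℂ) (c : ℝ) (ℓ : StrongDual ℂ (Fin m → ℂ)) :
    reAffine Z c ℓ = (ℓ Z).re + c := rfl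

theorem exists_eq_reAffine (f : StrongDual ℂ (Fin m → ℂ) →ᵃ[ℝ] ℝ) :
    ∃ Z c, f = reAffine Z c := by
  obtain ⟨Z, hZ⟩ := exists_re_apply_eq f.linear
  refine ⟨Z, f 0, AffineMap.ext fun ℓ => ?_⟩
  rw [reAffine_apply, ← hZ]
  exact congrFun f.decomp ℓ

theorem reAffine_eq_zero {Z : Fin m → ℂ} {c : ℝ} (h : reAffine Z c = 0) : Z = 0 ∧ c = 0 := by
  have h0 : c = 0 := by simpa using congrArg (fun f => f 0) h
  refine ⟨eq_zero_of_forall_re_eq_zero fun ℓ => ?_, h0⟩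
  simpa [h0] using congrArg (fun f => f ℓ) h

/-- The isomorphism `ℓ ↦ Re ℓ` from the complex dual of `ℂᵐ` onto its real dual. -/
noncomputable def reDualEquiv (m : ℕ) : StrongDual ℂ (Fin m → ℂ) ≃ₗ[ℝ] Dual ℝ (Fin m → ℂ) :=
  LinearEquiv.ofBijective (rePairing m).flip (by
    have hinj : Function.Injective (rePairing m).flip := by
      rw [injective_iff_map_eq_zero]
      intro ℓ hℓ
      ext1 Z
      have h : ∀ Z, (ℓ Z).re = 0 := fun Z => LinearMap.congr_fun hℓ Z
      have h2 := h (Complex.I • Z)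
      rw [map_smul, smul_eq_mul, Complex.I_mul_re, neg_eq_zero] at h2
      exact Complex.ext (h Z) h2
    refine ⟨hinj, (LinearMap.injective_iff_surjective_of_finrank_eq_finrank ?_).1 hinj⟩
    rw [Subspace.dual_finrank_eq, finrank_real_strongDual_pi, finrank_real_of_complex]
    simp)

@[simp]
theorem reDualEquiv_apply (ℓ : StrongDual ℂ (Fin m → ℂ)) (Z : Fin m → ℂ) :
    reDualEquiv m ℓ Z = (ℓ Z).re := rfl

end Dual

/-! ### The pair of a datum belongs to `𝒫`. -/

namespace Datum

variable (d : Datum)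

/-- Every real affine function has the form `ℓ ↦ Re ℓ(Z) + c`. The constant is invisible because the
rays sum to zero, and the minus sign in `ordMap` turns `Z` into `-Z`. -/
theorem sum_smul_ray_mem_subspace_iff (u : Fin (d.n + 1) → ℝ) :
    ∑ i, u i • ray d.n i ∈ d.subspace ↔
      ∃ f : StrongDual ℂ (Fin d.m → ℂ) →ᵃ[ℝ] ℝ, ∀ i, u i = f (d.ℓ i) := by
  constructor
  · rintro ⟨Z, hZ⟩
    refine ⟨reAffine (-Z) (u 0 + (d.ℓ 0 Z).re), fun i => ?_⟩
    rw [reAffine_apply, map_neg, Complex.neg_re]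
    induction i using Fin.cases with
    | zero => ring
    | succ j =>
      have h : -(d.ℓ j.succ Z - d.ℓ 0 Z).re = _ := congrFun hZ j
      rw [sum_smul_ray_apply, Complex.sub_re] at h
      linarith
  · rintro ⟨f, hf⟩
    obtain ⟨Z, c, rfl⟩ := exists_eq_reAffine f
    refine ⟨-Z, ?_⟩
    ext j
    change -(d.ℓ j.succ (-Z) - d.ℓ 0 (-Z)).re = _
    rw [sum_smul_ray_apply, hf, hf, reAffine_apply, reAffine_apply]
    simp only [map_neg, Complex.sub_re, Complex.neg_re]
    ring

theorem compl_ne_univ {P : Finset (Fin (d.n + 1))} (hP : P ∈ d.𝓔) : Pᶜ ≠ Finset.univ := by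
  intro h
  rw [Finset.compl_eq_univ_iff] at h
  have := d.card_eq P hP
  simp [h] at this

theorem affine_eq_zero_of_eq_zero {P : Finset (Fin (d.n + 1))} (hP : P ∈ d.𝓔)
    {f : StrongDual ℂ (Fin d.m → ℂ) →ᵃ[ℝ] ℝ} (hf : ∀ i ∈ P, f (d.ℓ i) = 0) : f = 0 := by
  refine AffineMap.ext_on (d.affine_basis P hP).2 ?_
  rintro _ ⟨i, hi, rfl⟩
  exact hf i hi

/-- The signs extend to the convex hulls, so at a common interior point `f` attains its maximum `0`
over the hull of `L_P`. -/
theorem affine_eq_zero_of_sign {P Q : Finset (Fin (d.n + 1))} (hP : P ∈ d.𝓔) (hQ : Q ∈ d.𝓔)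
    {f : StrongDual ℂ (Fin d.m → ℂ) →ᵃ[ℝ] ℝ} (hfP : ∀ i ∈ P, f (d.ℓ i) ≤ 0)
    (hfQ : ∀ i ∈ Q, 0 ≤ f (d.ℓ i)) : f = 0 := by
  obtain ⟨x, hxP, hxQ⟩ := d.imbrication P hP Q hQ
  refine affine_eq_zero_of_interior (s := convexHull ℝ (d.ℓ '' P)) (fun y hy => ?_) hxP ?_
  · refine convexHull_min (t := f ⁻¹' Set.Iic 0) ?_ ((convex_Iic 0).affine_preimage f) hy
    rintro _ ⟨i, hi, rfl⟩
    exact hfP i hi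
  · refine convexHull_min (t := f ⁻¹' Set.Ici 0) ?_ ((convex_Ici 0).affine_preimage f)
      (interior_subset hxQ)
    rintro _ ⟨i, hi, rfl⟩
    exact hfQ i hi

theorem fan_eq_image : d.fan = coneSpan (ray d.n) '' {J | ∃ P ∈ d.𝓔, J ⊆ Pᶜ} := by
  ext τ
  constructor
  · rintro ⟨P, hP, hτ⟩
    obtain ⟨J, hJ, rfl⟩ := (isFace_coneSpan_ray_iff (d.compl_ne_univ hP)).1 hτ
    exact ⟨J, ⟨P, hP, hJ⟩, rfl⟩
  · rintro ⟨J, ⟨P, hP, hJ⟩, rfl⟩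
    exact ⟨P, hP, (isFace_coneSpan_ray_iff (d.compl_ne_univ hP)).2 ⟨J, hJ, rfl⟩⟩

theorem coneSpan_compl_mem_fan {P : Finset (Fin (d.n + 1))} (hP : P ∈ d.𝓔) :
    coneSpan (ray d.n) Pᶜ ∈ d.fan := by
  rw [fan_eq_image]
  exact ⟨_, ⟨P, hP, subset_rfl⟩, rfl⟩

theorem isFan_fan : IsFan d.fan := by
  rw [fan_eq_image]
  refine isFan_of_simplicial ?_ ?_
  · rintro I ⟨P, hP, hI⟩
    exact ne_univ_of_subset (d.compl_ne_univ hP) hI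
  · rintro I ⟨P, hP, hI⟩ J hJ
    exact ⟨P, hP, hJ.trans hI⟩

theorem fan_subset_projectiveFan : d.fan ⊆ projectiveFan d.n := by
  rw [fan_eq_image]
  rintro _ ⟨J, ⟨P, hP, hJ⟩, rfl⟩
  exact mem_projectiveFan_iff.2 ⟨J, ne_univ_of_subset (d.compl_ne_univ hP) hJ, rfl⟩

theorem mem_fanSupport_iff {x : Fin d.n → ℝ} :
    x ∈ fanSupport d.fan ↔ ∃ P ∈ d.𝓔, x ∈ coneSpan (ray d.n) Pᶜ := by
  constructor
  · rintro ⟨σ, hσ, hx⟩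
    rw [fan_eq_image] at hσ
    obtain ⟨J, ⟨P, hP, hJ⟩, rfl⟩ := hσ
    exact ⟨P, hP, coneSpan_mono hJ hx⟩
  · rintro ⟨P, hP, hx⟩
    exact ⟨_, d.coneSpan_compl_mem_fan hP, hx⟩

/-- For two points with the same image, the coefficient difference `u - v` is an affine function of
the forms. It equals `-v` on `P` and `u` on `Q`, which gives the signs required by
`affine_eq_zero_of_sign`. -/
theorem injOn_fanSupport : Set.InjOn d.subspace.mkQ (fanSupport d.fan) := by
  intro x hx y hy hxy
  obtain ⟨P, hP, hx⟩ := d.mem_fanSupport_iff.1 hx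
  obtain ⟨Q, hQ, hy⟩ := d.mem_fanSupport_iff.1 hy
  obtain ⟨u, hu, hu0, rfl⟩ := mem_coneSpan_iff_support.1 hx
  obtain ⟨v, hv, hv0, rfl⟩ := mem_coneSpan_iff_support.1 hy
  rw [Submodule.mkQ_apply, Submodule.mkQ_apply, Submodule.Quotient.eq,
    ← Finset.sum_sub_distrib] at hxy
  simp only [← sub_smul] at hxy
  obtain ⟨f, hf⟩ := (d.sum_smul_ray_mem_subspace_iff fun i => u i - v i).1 hxy
  have hf0 : f = 0 := by
    refine d.affine_eq_zero_of_sign hP hQ (fun i hi => ?_) fun i hi => ?_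
    · rw [← hf, hu0 i (by simpa using hi), zero_sub, neg_nonpos]
      exact hv i
    · rw [← hf, hv0 i (by simpa using hi), sub_zero]
      exact hu i
  refine Finset.sum_congr rfl fun i _ => ?_
  have := hf i
  rw [hf0, AffineMap.coe_zero, Pi.zero_apply, sub_eq_zero] at this
  rw [this]

/-- A kernel element `Z` makes `ℓ ↦ Re ℓ(Z) - Re ℓ_0(Z)` vanish on every `ℓ_i`, in particular on an
affine basis. -/
theorem ordMap_injective : Function.Injective d.ordMap := by
  rw [injective_iff_map_eq_zero]
  intro Z hZ
  obtain ⟨P, hP⟩ := d.nonempty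
  have hre : ∀ i, (d.ℓ i Z).re = (d.ℓ 0 Z).re := by
    intro i
    induction i using Fin.cases with
    | zero => rfl
    | succ j =>
      have h : -(d.ℓ j.succ Z - d.ℓ 0 Z).re = 0 := congrFun hZ j
      rw [Complex.sub_re] at h
      linarith
  exact (reAffine_eq_zero (d.affine_eq_zero_of_eq_zero hP (f := reAffine Z (-(d.ℓ 0 Z).re))
    fun i _ => by rw [reAffine_apply, hre i, add_neg_cancel])).1

theorem finrank_subspace : finrank ℝ d.subspace = 2 * d.m := by
  rw [subspace, LinearMap.finrank_range_of_inj d.ordMap_injective, finrank_real_of_complex]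
  simp

theorem finrank_quotient_subspace : finrank ℝ ((Fin d.n → ℝ) ⧸ d.subspace) = d.n - 2 * d.m := by
  rw [Submodule.finrank_quotient, d.finrank_subspace]
  simp

theorem card_compl {P : Finset (Fin (d.n + 1))} (hP : P ∈ d.𝓔) :
    Pᶜ.card = finrank ℝ ((Fin d.n → ℝ) ⧸ d.subspace) := by
  rw [Finset.card_compl, d.card_eq P hP, d.finrank_quotient_subspace, Fintype.card_fin]
  omega

theorem exists_mem_coneSpan_compl (w : (Fin d.n → ℝ) ⧸ d.subspace) :
    ∃ P ∈ d.𝓔, w ∈ coneSpan (fun i => d.subspace.mkQ (ray d.n i)) Pᶜ := by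
  -- Closedness supplies the normed space structure on the quotient.
  have : IsClosed (d.subspace : Set (Fin d.n → ℝ)) := d.subspace.closed_of_finiteDimensional
  have hinj : ∀ P ∈ d.𝓔, ∀ Q ∈ d.𝓔,
      Set.InjOn d.subspace.mkQ (coneSpan (ray d.n) Pᶜ ∪ coneSpan (ray d.n) Qᶜ) :=
    fun P hP Q hQ => d.injOn_fanSupport.mono fun x hx => d.mem_fanSupport_iff.2 <|
      hx.elim (fun h => ⟨P, hP, h⟩) fun h => ⟨Q, hQ, h⟩
  obtain ⟨_, ⟨P, hP, rfl⟩, hw⟩ := exists_mem_coneSpan_of_exchange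
    (v := fun i => d.subspace.mkQ (ray d.n i)) (F := compl '' d.𝓔) (d.nonempty.image _)
    (by
      rintro _ ⟨P, hP, rfl⟩
      exact d.card_compl hP)
    (by
      rintro _ ⟨P, hP, rfl⟩
      exact linearIndependent_of_injOn_coneSpan ((hinj P hP P hP).mono Set.subset_union_left)
        (linearIndependent_ray (d.compl_ne_univ hP)))
    (by
      rintro _ ⟨P, hP, rfl⟩ _ ⟨Q, hQ, rfl⟩ x hxP hxQ
      exact mem_coneSpan_map_ray_inter (d.compl_ne_univ hP) (d.compl_ne_univ hQ)
        (hinj P hP Q hQ) hxP hxQ)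
    (by
      rintro _ ⟨P, hP, rfl⟩ i hi
      -- In terms of complements, SEP removes `i` from the cone and inserts `j`.
      obtain ⟨j, hj, hmem⟩ := d.sep P hP i
      refine ⟨j, by simpa using hj, _, hmem, ?_⟩
      ext k
      simp only [Finset.mem_compl, Finset.mem_insert, Finset.mem_erase] at hi ⊢
      by_cases hkj : k = j
      · subst hkj
        simp only [ne_eq, not_true_eq_false, false_and, or_false, true_or, iff_true]
        rintro rfl
        exact hi hj
      · simp [hkj]) w
  exact ⟨P, hP, hw⟩

theorem toricPair_mem_toricPairs : d.toricPair ∈ toricPairs := by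
  refine ⟨⟨d.m, d.m_pos, d.finrank_subspace⟩, d.isFan_fan, d.fan_subset_projectiveFan,
    d.injOn_fanSupport, Set.eq_univ_iff_forall.2 fun w => ?_⟩
  obtain ⟨P, hP, hw⟩ := d.exists_mem_coneSpan_compl w
  refine ⟨_, ⟨_, d.coneSpan_compl_mem_fan hP, rfl⟩, ?_⟩
  beta_reduce
  change w ∈ d.subspace.mkQ '' _
  rwa [image_coneSpan]

end Datum

end LVMB

/-! ### Passing between subspaces and families of forms. -/

namespace LVMB

open Module

section Forms

variable {m n : ℕ}

/-- If two families of forms define injective real-linear maps with the same image, then a real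
affine automorphism carries one family to the other. -/
theorem exists_affineEquiv_of_range_eq {ℓ ℓ' : Fin (n + 1) → StrongDual ℂ (Fin m → ℂ)}
    {g g' : (Fin m → ℂ) →ₗ[ℝ] (Fin n → ℝ)} (hg : Function.Injective g)
    (hg' : Function.Injective g') (hr : LinearMap.range g' = LinearMap.range g)
    (hgℓ : ∀ Z j, g Z j = -(ℓ j.succ Z - ℓ 0 Z).re)
    (hgℓ' : ∀ Z j, g' Z j = -(ℓ' j.succ Z - ℓ' 0 Z).re) :
    ∃ φ : StrongDual ℂ (Fin m → ℂ) ≃ᵃ[ℝ] StrongDual ℂ (Fin m → ℂ), ∀ i, φ (ℓ i) = ℓ' i := by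
  -- With `θ = g⁻¹ ∘ g'` on the common image, the transpose of `θ` matches the differences `ℓ_j -
  -- ℓ_0`, and a translation then matches `ℓ_0`.
  let θ : (Fin m → ℂ) ≃ₗ[ℝ] (Fin m → ℂ) :=
    ((LinearEquiv.ofInjective g' hg').trans (LinearEquiv.ofEq _ _ hr)).trans
      (LinearEquiv.ofInjective g hg).symm
  have hθ : ∀ Z, g (θ Z) = g' Z := by
    intro Z
    exact congrArg Subtype.val ((LinearEquiv.ofInjective g hg).apply_symm_apply
      ((LinearEquiv.ofEq _ _ hr) (LinearEquiv.ofInjective g' hg' Z)))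
  let Λ : StrongDual ℂ (Fin m → ℂ) ≃ₗ[ℝ] StrongDual ℂ (Fin m → ℂ) :=
    ((reDualEquiv m).trans θ.dualMap).trans (reDualEquiv m).symm
  have hΛ : ∀ ℓ Z, (Λ ℓ Z).re = (ℓ (θ Z)).re := by
    intro ℓ Z
    rw [← reDualEquiv_apply]
    simp [Λ]
  refine ⟨Λ.toAffineEquiv.trans (AffineEquiv.constVAdd ℝ _ (ℓ' 0 - Λ (ℓ 0))), fun i => ?_⟩
  change (ℓ' 0 - Λ (ℓ 0)) + Λ (ℓ i) = ℓ' i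
  refine (reDualEquiv m).injective (LinearMap.ext fun Z => ?_)
  simp only [reDualEquiv_apply, add_apply, sub_apply,
    Complex.add_re, Complex.sub_re, hΛ]
  induction i using Fin.cases with
  | zero => ring
  | succ j =>
    have := congrFun (hθ Z) j
    rw [hgℓ, hgℓ', Complex.sub_re, Complex.sub_re] at this
    linarith

/-- Every `2m`-dimensional subspace of `ℝⁿ` is defined by linear forms on `ℂᵐ`. -/
theorem exists_forms (E : Submodule ℝ (Fin n → ℝ)) (hE : finrank ℝ E = 2 * m) :
    ∃ ℓ : Fin (n + 1) → StrongDual ℂ (Fin m → ℂ),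
      (∀ f : StrongDual ℂ (Fin m → ℂ) →ᵃ[ℝ] ℝ, ∑ i, f (ℓ i) • ray n i ∈ E) ∧
      (∀ x ∈ E, ∃ Z, ∀ j : Fin n, -(ℓ j.succ Z - ℓ 0 Z).re = x j) ∧
      ∀ f : StrongDual ℂ (Fin m → ℂ) →ᵃ[ℝ] ℝ, (∀ i, f (ℓ i) = 0) → f = 0 := by
  let g : (Fin m → ℂ) ≃ₗ[ℝ] E := LinearEquiv.ofFinrankEq _ _ (by
    rw [hE, finrank_real_of_complex]
    simp)
  -- Translation freedom allows `ℓ_0 = 0`; the real parts of the other forms are minus the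
  -- coordinates of a parametrisation of `E`.
  let ℓ : Fin (n + 1) → StrongDual ℂ (Fin m → ℂ) := Fin.cons 0 fun j =>
    (reDualEquiv m).symm (-(LinearMap.proj j ∘ₗ E.subtype ∘ₗ g.toLinearMap))
  have h0 : ℓ 0 = 0 := rfl
  have hℓ : ∀ j Z, (ℓ (Fin.succ j) Z).re = -(g Z : Fin n → ℝ) j := by
    intro j Z
    rw [← reDualEquiv_apply]
    simp [ℓ]
  refine ⟨ℓ, fun f => ?_, fun x hx => ⟨g.symm ⟨x, hx⟩, fun j => ?_⟩, fun f hf => ?_⟩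
  · obtain ⟨Z, c, rfl⟩ := exists_eq_reAffine f
    have : ∑ i, reAffine Z c (ℓ i) • ray n i = g (-Z) := by
      ext j
      rw [sum_smul_ray_apply, reAffine_apply, reAffine_apply, hℓ, h0]
      simp
    rw [this]
    exact (g (-Z)).2
  · rw [Complex.sub_re, hℓ, h0]
    simp
  · obtain ⟨Z, c, rfl⟩ := exists_eq_reAffine f
    have hc : c = 0 := by simpa [h0] using hf 0
    subst hc
    have hZ : g Z = 0 := by
      ext j
      simpa [hℓ] using hf j.succ
    obtain rfl : Z = 0 := by simpa using hZ
    ext ℓ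
    change _ = (0 : ℝ)
    simp

/-- A proper direction space lies in the kernel of a nonzero form, which is constant on `s`;
subtracting that constant contradicts the hypothesis. -/
theorem affineSpan_eq_top_of_forall_eq_zero {V : Type*} [AddCommGroup V] [Module ℝ V] {s : Set V}
    (hs : s.Nonempty) (h : ∀ f : V →ᵃ[ℝ] ℝ, (∀ x ∈ s, f x = 0) → f = 0) :
    affineSpan ℝ s = ⊤ := by
  rw [AffineSubspace.affineSpan_eq_top_iff_vectorSpan_eq_top_of_nonempty ℝ V V hs]
  by_contra hne
  obtain ⟨f, hf, hker⟩ := Submodule.exists_le_ker_of_lt_top _ (lt_top_iff_ne_top.2 hne)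
  obtain ⟨p, hp⟩ := hs
  have h0 : f.toAffineMap - AffineMap.const ℝ V (f p) = 0 := by
    refine h _ fun x hx => ?_
    have : f (x -ᵥ p) = 0 := hker (vsub_mem_vectorSpan ℝ hx hp)
    rw [vsub_eq_sub, map_sub] at this
    exact this
  have h1 : ∀ x, f x - f p = 0 := fun x => congrArg (fun g : V →ᵃ[ℝ] ℝ => g x) h0
  have h2 : f p = 0 := by simpa using h1 0
  refine hf (LinearMap.ext fun x => ?_)
  simpa [h2] using h1 x

end Forms

/-! ### The pair determines exactly the equivalence class. -/

namespace Datum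

/-- This recovers the index family from the pair. A cone `σ_P` of the fan is a face of some `σ_Q`,
so `Q ⊆ P`, and equal cardinalities give `P = Q`. -/
theorem mem_family_iff (d : Datum) {P : Finset (Fin (d.n + 1))} :
    P ∈ d.𝓔 ↔ P.card = finrank ℝ d.subspace + 1 ∧ coneSpan (ray d.n) Pᶜ ∈ d.fan := by
  rw [d.finrank_subspace]
  refine ⟨fun h => ⟨d.card_eq P h, d.coneSpan_compl_mem_fan h⟩, ?_⟩
  rintro ⟨hc, hP⟩
  rw [fan_eq_image] at hP
  obtain ⟨J, ⟨Q, hQ, hJ⟩, hJP⟩ := hP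
  have hQu := d.compl_ne_univ hQ
  have hPu : Pᶜ ≠ Finset.univ := by
    intro h
    rw [Finset.compl_eq_univ_iff] at h
    simp [h] at hc
  obtain rfl := coneSpan_ray_injective hPu (ne_univ_of_subset hQu hJ) hJP
  have hQP : Q ⊆ P := Finset.compl_subset_compl.1 hJ
  rwa [← Finset.eq_of_subset_of_card_le hQP (by rw [hc, d.card_eq Q hQ])]

/-- Composition with `φ` or its inverse carries affine functions to affine functions, so both
families of forms yield the same value vectors and hence the same `E`. -/
theorem toricPair_eq_of_rel {d d' : Datum} (h : Rel d d') : d.toricPair = d'.toricPair := by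
  obtain ⟨m, n, m_pos, two_mul_m_le, ℓ, 𝓔, nonempty, card_eq, affine_basis, sep, imb⟩ := d
  obtain ⟨m', n', m_pos', two_mul_m_le', ℓ', 𝓔', nonempty', card_eq', affine_basis', sep',
    imb'⟩ := d'
  obtain ⟨hm, hn, h𝓔, φ, hφ⟩ := h
  dsimp only at hm hn h𝓔 φ hφ
  obtain rfl : n = n' := Nat.succ_injective hn
  subst hm
  simp only [map_finCongr_self] at h𝓔
  obtain rfl : 𝓔 = 𝓔' := Set.ext h𝓔
  simp only [toricPair]
  congr 2
  ext x
  obtain ⟨u, rfl⟩ := exists_sum_smul_ray x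
  rw [sum_smul_ray_mem_subspace_iff, sum_smul_ray_mem_subspace_iff]
  constructor
  · rintro ⟨f, hf⟩
    refine ⟨f.comp φ.symm.toAffineMap, fun i => ?_⟩
    have : φ.symm (ℓ' i) = ℓ i := (AffineEquiv.symm_apply_eq φ).2 (hφ i).symm
    exact (hf i).trans (congrArg f this.symm)
  · rintro ⟨f, hf⟩
    refine ⟨f.comp φ.toAffineMap, fun i => ?_⟩
    rw [hf i]
    exact congrArg f (hφ i).symm

theorem rel_of_toricPair_eq {d d' : Datum} (h : d.toricPair = d'.toricPair) : Rel d d' := by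
  have hdim := d.finrank_subspace
  have hdim' := d'.finrank_subspace
  have hinj := d.ordMap_injective
  have hinj' := d'.ordMap_injective
  have hmem := fun P => d.mem_family_iff (P := P)
  have hmem' := fun P => d'.mem_family_iff (P := P)
  obtain ⟨m, n, m_pos, two_mul_m_le, ℓ, 𝓔, nonempty, card_eq, affine_basis, sep, imb⟩ := d
  obtain ⟨m', n', m_pos', two_mul_m_le', ℓ', 𝓔', nonempty', card_eq', affine_basis', sep',
    imb'⟩ := d'
  simp only [toricPair, Sigma.mk.injEq] at h
  obtain ⟨hn, h⟩ := h
  subst hn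
  simp only [heq_eq_eq, Prod.mk.injEq] at h
  obtain ⟨hE, hΔ⟩ := h
  rw [hE, hdim'] at hdim
  dsimp only at hdim
  obtain rfl : m = m' := by omega
  refine ⟨rfl, rfl, fun P => ?_, ?_⟩
  · rw [map_finCongr_self, hmem, hmem', hE, hΔ]
  · exact exists_affineEquiv_of_range_eq hinj hinj' hE.symm (fun _ _ => rfl) fun _ _ => rfl

end Datum

/-! ### Every pair in `𝒫` comes from a datum. -/

theorem exists_toricPair_eq {p : PrePair} (hp : p ∈ toricPairs) :
    ∃ d : Datum, d.toricPair = p := by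
  obtain ⟨n, E, Δ⟩ := p
  obtain ⟨⟨m, hm, hE⟩, hfan, hsub, hinj, hcov⟩ := hp
  dsimp only at hE hfan hsub hinj hcov
  have : IsClosed (E : Set (Fin n → ℝ)) := E.closed_of_finiteDimensional
  have hmn : 2 * m ≤ n := by
    rw [← hE]
    simpa using E.finrank_le
  have hW : finrank ℝ ((Fin n → ℝ) ⧸ E) = n - 2 * m := by
    rw [Submodule.finrank_quotient, hE]
    simp
  let v : Fin (n + 1) → (Fin n → ℝ) ⧸ E := fun i => E.mkQ (ray n i)
  let K : Set (Finset (Fin (n + 1))) := {J | J ≠ Finset.univ ∧ coneSpan (ray n) J ∈ Δ}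
  have hinjK : ∀ I ∈ K, ∀ J ∈ K, Set.InjOn E.mkQ (coneSpan (ray n) I ∪ coneSpan (ray n) J) :=
    fun I hI J hJ => hinj.mono (Set.union_subset (Set.subset_sUnion_of_mem hI.2)
      (Set.subset_sUnion_of_mem hJ.2))
  have hliK : ∀ I ∈ K, LinearIndependent ℝ (fun i : I => v i) := fun I hI =>
    linearIndependent_of_injOn_coneSpan ((hinjK I hI I hI).mono Set.subset_union_left)
      (linearIndependent_ray hI.1)
  have hcovK : ∀ w, ∃ I ∈ K, w ∈ coneSpan v I := by
    intro w
    obtain ⟨_, ⟨σ, hσ, rfl⟩, hw⟩ := Set.eq_univ_iff_forall.1 hcov w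
    obtain ⟨J, hJ, rfl⟩ := mem_projectiveFan_iff.1 (hsub hσ)
    refine ⟨J, ⟨hJ, hσ⟩, ?_⟩
    beta_reduce at hw
    rwa [image_coneSpan] at hw
  -- The complements of these maximal index sets will be the index family; the full-dimensional
  -- cones alone already cover the quotient.
  let F : Set (Finset (Fin (n + 1))) := {I | I ∈ K ∧ I.card = finrank ℝ ((Fin n → ℝ) ⧸ E)}
  have hcovF : ∀ w, ∃ I ∈ F, w ∈ coneSpan v I := by
    intro w
    obtain ⟨I, hI, hc, hw⟩ := exists_mem_coneSpan_card_eq_finrank hliK hcovK w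
    exact ⟨I, ⟨hI, hc⟩, hw⟩
  have hexch : ∀ I ∈ F, ∀ i ∈ I, ∃ j ∉ I, insert j (I.erase i) ∈ F := fun I hI i hi =>
    exists_exchange_of_forall_mem_coneSpan (fun I hI => hI.2) (fun I hI => hliK I hI.1)
      (fun I hI J hJ x hxI hxJ => mem_coneSpan_map_ray_inter hI.1.1 hJ.1.1
        (hinjK I hI.1 J hJ.1) hxI hxJ) hcovF hI hi
  obtain ⟨ℓ, hℓE, hEℓ, hℓ0⟩ := exists_forms E hE
  have hcard : ∀ P, Pᶜ ∈ F → P.card = 2 * m + 1 := by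
    intro P hP
    have h1 := hP.2
    rw [hW] at h1
    have h2 := P.card_add_card_compl
    rw [Fintype.card_fin] at h2
    omega
  have hne : ∀ P, Pᶜ ∈ F → P.Nonempty := fun P hP => by
    rw [← Finset.card_pos, hcard P hP]
    omega
  -- A real affine function which is nonpositive on `L_P` and nonnegative on `L_Q` vanishes.
  have hsign : ∀ P, Pᶜ ∈ F → ∀ Q, Qᶜ ∈ F → ∀ f : StrongDual ℂ (Fin m → ℂ) →ᵃ[ℝ] ℝ,
      (∀ i ∈ P, f (ℓ i) ≤ 0) → (∀ i ∈ Q, 0 ≤ f (ℓ i)) → f = 0 := by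
    intro P hP Q hQ f hfP hfQ
    -- The positive and negative parts of the values of `f` define points of the cones on `Pᶜ` and
    -- `Qᶜ`. Their difference lies in `E`, so injectivity identifies them and unique coefficients
    -- give `f⁺ = f⁻` at every form.
    have hu0 : ∀ i ∈ P, (f (ℓ i))⁺ = 0 := fun i hi => posPart_eq_zero.2 (hfP i hi)
    have hv0 : ∀ i ∈ Q, (f (ℓ i))⁻ = 0 := fun i hi => negPart_eq_zero.2 (hfQ i hi)
    have hu : ∑ i, (f (ℓ i))⁺ • ray n i ∈ coneSpan (ray n) Pᶜ :=
      mem_coneSpan_iff_support.2 ⟨fun i => (f (ℓ i))⁺, fun i => posPart_nonneg _,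
        fun i hi => hu0 i (by simpa using hi), rfl⟩
    have hv : ∑ i, (f (ℓ i))⁻ • ray n i ∈ coneSpan (ray n) Qᶜ :=
      mem_coneSpan_iff_support.2 ⟨fun i => (f (ℓ i))⁻, fun i => negPart_nonneg _,
        fun i hi => hv0 i (by simpa using hi), rfl⟩
    have heq : ∑ i, (f (ℓ i))⁺ • ray n i = ∑ i, (f (ℓ i))⁻ • ray n i := by
      refine hinjK _ hP.1 _ hQ.1 (Or.inl hu) (Or.inr hv) ?_
      rw [Submodule.mkQ_apply, Submodule.mkQ_apply, Submodule.Quotient.eq,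
        ← Finset.sum_sub_distrib]
      simpa only [← sub_smul, posPart_sub_negPart] using hℓE f
    obtain ⟨i, hi⟩ := hne P hP
    obtain ⟨j, hj⟩ := hne Q hQ
    have huv := eq_of_sum_smul_ray_eq (u := fun i => (f (ℓ i))⁺)
      (v := fun i => (f (ℓ i))⁻) (fun i => posPart_nonneg _) (fun i => negPart_nonneg _)
      ⟨i, hu0 i hi⟩ ⟨j, hv0 j hj⟩ heq
    refine hℓ0 f fun k => ?_
    rw [← posPart_sub_negPart (f (ℓ k)), sub_eq_zero]
    exact congrFun huv k
  have hspan : ∀ P, Pᶜ ∈ F → affineSpan ℝ (ℓ '' (P : Set (Fin (n + 1)))) = ⊤ := fun P hP =>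
    affineSpan_eq_top_of_forall_eq_zero ((Finset.coe_nonempty.2 (hne P hP)).image _) fun f hf =>
      hsign P hP P hP f (fun i hi => (hf _ ⟨i, hi, rfl⟩).le) fun i hi => (hf _ ⟨i, hi, rfl⟩).ge
  let d : Datum :=
    { m := m
      n := n
      m_pos := hm
      two_mul_m_le := hmn
      ℓ := ℓ
      𝓔 := {P | Pᶜ ∈ F}
      nonempty := by
        obtain ⟨I, hI, -⟩ := hcovF 0
        exact ⟨Iᶜ, by simpa using hI⟩
      card_eq := hcard
      affine_basis := by
        intro P hP
        refine ⟨?_, hspan P hP⟩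
        -- A set of `2m + 1` points spanning a space of real dimension `2m` is affinely independent.
        rw [affineIndependent_iff_finrank_vectorSpan_eq ℝ _ (n := 2 * m)
          (by rw [Fintype.card_coe]; exact hcard P hP)]
        have h1 : Set.range (fun i : P => ℓ i) = ℓ '' (P : Set (Fin (n + 1))) := by
          ext x
          simp
        rw [h1, AffineSubspace.vectorSpan_eq_top_of_affineSpan_eq_top ℝ _ _ (hspan P hP),
          finrank_top, finrank_real_strongDual_pi]
      sep := by
        intro P hP i
        by_cases hi : i ∈ P
        · exact ⟨i, hi, by rwa [Finset.insert_erase hi]⟩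
        · obtain ⟨j, hj, hmem⟩ := hexch _ hP i (Finset.mem_compl.2 hi)
          have hjP : j ∈ P := by simpa using hj
          refine ⟨j, hjP, ?_⟩
          have : (insert i (P.erase j))ᶜ = insert j (Pᶜ.erase i) := by
            ext k
            simp only [Finset.mem_compl, Finset.mem_insert, Finset.mem_erase]
            by_cases hkj : k = j
            · subst hkj
              simp only [ne_eq, not_true_eq_false, false_and, or_false, true_or, iff_true]
              rintro rfl
              exact hi hjP
            · simp [hkj]
          change (insert i (P.erase j))ᶜ ∈ F
          rwa [this]
      imbrication := by
        intro P hP Q hQ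
        -- Disjoint interiors are separated strictly by a hyperplane; passing to closures gives weak
        -- inequalities at the vertices, and `hsign` then makes the separating affine function zero,
        -- contradicting strictness.
        rw [← Set.not_disjoint_iff_nonempty_inter]
        intro hdisj
        have hintP := interior_convexHull_nonempty_iff_affineSpan_eq_top.2 (hspan P hP)
        have hintQ := interior_convexHull_nonempty_iff_affineSpan_eq_top.2 (hspan Q hQ)
        obtain ⟨f, c, hfP, hfQ⟩ := geometric_hahn_banach_open_open
          (convex_convexHull ℝ _).interior isOpen_interior
          (convex_convexHull ℝ _).interior isOpen_interior hdisj
        have hclP := (convex_convexHull ℝ _).closure_interior_eq_closure_of_nonempty_interior hintP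
        have hclQ := (convex_convexHull ℝ _).closure_interior_eq_closure_of_nonempty_interior hintQ
        have hP' : ∀ i ∈ P, f (ℓ i) ≤ c := by
          intro i hi
          have : ℓ i ∈ closure (interior (convexHull ℝ (ℓ '' (P : Set (Fin (n + 1)))))) := by
            rw [hclP]
            exact subset_closure (subset_convexHull ℝ _ ⟨i, hi, rfl⟩)
          exact closure_minimal (fun x hx => (hfP x hx).le)
            (isClosed_le f.continuous continuous_const) this
        have hQ' : ∀ i ∈ Q, c ≤ f (ℓ i) := by
          intro i hi
          have : ℓ i ∈ closure (interior (convexHull ℝ (ℓ '' (Q : Set (Fin (n + 1)))))) := by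
            rw [hclQ]
            exact subset_closure (subset_convexHull ℝ _ ⟨i, hi, rfl⟩)
          exact closure_minimal (fun x hx => (hfQ x hx).le)
            (isClosed_le continuous_const f.continuous) this
        have h0 := hsign P hP Q hQ (f.toLinearMap.toAffineMap - AffineMap.const ℝ _ c)
          (fun i hi => sub_nonpos.2 (hP' i hi)) fun i hi => sub_nonneg.2 (hQ' i hi)
        obtain ⟨x, hx⟩ := hintP
        have h1 : f x - c = 0 := congrArg (fun g => g x) h0
        exact (hfP x hx).ne (sub_eq_zero.1 h1) }
  refine ⟨d, ?_⟩
  have hsubspace : d.subspace = E := by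
    ext x
    constructor
    · obtain ⟨u, rfl⟩ := exists_sum_smul_ray x
      rw [Datum.sum_smul_ray_mem_subspace_iff]
      rintro ⟨f, hf⟩
      simp only [hf]
      exact hℓE f
    · intro hx
      obtain ⟨Z, hZ⟩ := hEℓ x hx
      exact ⟨Z, funext hZ⟩
  have hfanΔ : d.fan = Δ := by
    rw [Datum.fan_eq_image]
    ext τ
    constructor
    · rintro ⟨J, ⟨P, hP, hJ⟩, rfl⟩
      have hP' : Pᶜ ∈ F := hP
      exact hfan.face_mem _ hP'.1.2 _ ((isFace_coneSpan_ray_iff hP'.1.1).2 ⟨J, hJ, rfl⟩)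
    · intro hτ
      obtain ⟨J, hJ, rfl⟩ := mem_projectiveFan_iff.1 (hsub hτ)
      -- Every cone of `Δ` is a face of a full-dimensional one: the image of this relative interior
      -- point is covered by such a cone, and injectivity puts the point itself in it.
      have hxJ := mem_coneSpan_of_nonneg (v := ray n) (S := J) (c := fun _ => 1)
        fun _ _ => zero_le_one
      obtain ⟨I, hI, hw⟩ := hcovF (E.mkQ (∑ i ∈ J, (1 : ℝ) • ray n i))
      rw [← image_coneSpan] at hw
      obtain ⟨y, hy, hyx⟩ := hw
      obtain rfl := hinjK I hI.1 J ⟨hJ, hτ⟩ (Or.inl hy) (Or.inr hxJ) hyx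
      refine ⟨J, ⟨Iᶜ, ?_, ?_⟩, rfl⟩
      · change Iᶜᶜ ∈ F
        rwa [compl_compl]
      · rw [compl_compl]
        exact subset_of_sum_smul_ray_mem hI.1.1 hJ hy
  change (⟨n, d.subspace, d.fan⟩ : PrePair) = ⟨n, E, Δ⟩
  rw [hsubspace, hfanΔ]

end LVMB

/-- Sending an LVMB datum to its pair `(E, Δ)` induces a bijection from the set of LVMB data
modulo `≈` onto `𝒫`. -/
theorem proposition2p8 :
    ∃ F : Quotient LVMB.Datum.setoid ≃ LVMB.toricPairs,
      ∀ d : LVMB.Datum,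
        (F (Quotient.mk LVMB.Datum.setoid d) : LVMB.PrePair) = d.toricPair := by
  refine ⟨Equiv.ofBijective (Quotient.lift
    (fun d : LVMB.Datum => (⟨d.toricPair, d.toricPair_mem_toricPairs⟩ : LVMB.toricPairs))
    fun d d' h => Subtype.ext (LVMB.Datum.toricPair_eq_of_rel h)) ⟨?_, ?_⟩, fun d => rfl⟩
  · rintro ⟨d⟩ ⟨d'⟩ h
    exact Quotient.sound (LVMB.Datum.rel_of_toricPair_eq (congrArg Subtype.val h))
  · rintro ⟨p, hp⟩
    obtain ⟨d, rfl⟩ := LVMB.exists_toricPair_eq hp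
    exact ⟨Quotient.mk _ d, rfl⟩
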